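/- **Diagrams.** Fix a set $C$ of wire labels. Diagrams $D:l\to l'$ between finite lists of labels are the terms built by sequential composition $E\circ D$ and parallel composition $D\otimes E$ from identities, swaps $[a,b]\to[b,a]$, cups $[a,a]\to[\,]$, caps $[\,]\to[a,a]$, and the generators * Z-spiders $Z^a_r:[a]^n\to[a]^m$ ($r\in\mathbb C$, $n,m\ge 0$; we write $Z^a=Z^a_1$); * W-nodes $W:[a]\to[b_1,\dots,b_n]$ ($n\ge0$); * the state $|1\rangle_a:[\,]\to[a]$, and global scalars $r:[\,]\to[\,]$ ($r\in\mathbb C$). $\mathrm{ZW}_d$-diagrams ($d\ge 2$) have a single label, so $D:n\to m$ with $n,m\in\mathbb N$. For $\mathrm{ZW}_f$-diagrams the labels are the capacities $a\in\{1,2,\dots\}$, and $W:[a]\to[b_1,\dots,b_n]$ requires $a\ge\max_i b_i$. *Derived diagrams.* $W^{\mathsf T}:[b_1,\dots,b_n]\to[a]$ is the W-node turned upside down with cups and caps. $|0\rangle_a$ is $W^{\mathsf T}:[\,]\to[a]$, and $|k{+}1\rangle_a:=W^{\mathsf T}\circ(|k\rangle_a\otimes|1\rangle_a)$ for $k\ge1$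 with $W^{\mathsf T}:[a,a]\to[a]$. $\varepsilon_a:=Z^a:[a]\to[\,]$, and $\lambda_a:[a]\to[\,]$ is $Z^a:[a]\to[a,a]$ followed by a cup. For a list $A=[a_1,\dots,a_n]$ and a label $b$, $R_{A,b}:A\to A$ copies every wire $i$ with $Z^{a_i}:[a_i]\to[a_i,a_i]$, outputs the first copies, merges all second copies with $W^{\mathsf T}:A\to[b]$ and applies $\varepsilon_b$ to the result. *Equations common to both theories.* (1) The laws of strict symmetric monoidal categories with a compact structure: the swap is involutive and natural, $\mathrm{swap}\circ\mathrm{cap}=\mathrm{cap}$, and the two snake equations. (2) Legs of a Z-spider may be bent (inputs into outputs and conversely) and permuted, and outputs of a W-node may be permuted. (3) The axioms * (s) two spiders $Z^a_r,Z^a_s$ joined by exactly one wire fuse into $Z^a_{rs}$ carrying the remaining legs; * (id) $W:[a]\to[a]$ is the identity; * (b$_1$) for $n\ne0$: $Z^a_r:[a]^n\to[a]$ followed by $W:[a]\to[b_1,\dots,b_m]$ equals $n$ copies of this $W$, one on each input, whose $j$-th outputs are joined, for every $j$, by $Z^{b_j}_r:[b_j]^n\to[b_j]$; * (+) the states $Z^a_r,Z^a_s:[\,]\to[a]$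 merged by $W^{\mathsf T}:[a,a]\to[a]$ give $Z^a_{r+s}:[\,]\to[a]$; * (cp) $|1\rangle_a$ followed by $Z^a_r:[a]\to[a]^n$ equals $r\cdot|1\rangle_a^{\otimes n}$, for $n\geq 0$. *Remaining axioms of $\mathrm{ZW}_d$* (labels omitted). * (a) a W-node with an output plugged into the input of another W-node equals the merged W-node; * (h) $W:1\to d$ followed by $Z:d\to1$ equals $|0\rangle\otimes Z_0$, with $Z_0:1\to0$; * (b$_2$) for $n,m\ge0$: $W^{\mathsf T}:n\to1$ followed by $W:1\to m$ equals $R$ (on $n$ wires) followed by the complete bipartite diagram with a node $W:1\to m$ on every input and a node $W^{\mathsf T}:n\to1$ on every output; * (e) $\varepsilon\circ|k\rangle$ is the empty diagram, for $0\le k<d$; * ($\ell$) $|1\rangle$ followed by $W:1\to2$, with $Z:1\to2$ followed by $Z:2\to1$ on one output, equals $|1\rangle$ followed by $W:1\to 2$; * (u) $Z:0\to1$ equals $\frac1{(d-1)!}\cdot(\mathrm{id}\otimes\lambda)\circ W\circ|d-1\rangle$ with $W:1\to2$. *Remaining axioms of $\mathrm{ZW}_f$.* * (a) as above, for an outer W-node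 with input capacity $c$ whose output $b$ is plugged into $W:[b]\to[a_1,\dots,a_n]$, provided that $b=c$ or $b\ge\sum_ia_i$; * (o) for $c\ge b\ge\max_i a_i$ and $A=[a_1,\dots,a_n]$: $W:[c]\to[b]$ followed by $W:[b]\to A$ equals $W:[c]\to A$ followed by $R_{A,b}$; * (b$_2$) for $c\ge\min(\sum_ia_i,\sum_jb_j)$, $c\ge a_i,b_j$: $W^{\mathsf T}:[a_1,\dots,a_n]\to[c]$ followed by $W:[c]\to[b_1,\dots,b_m]$ equals the complete bipartite diagram with a node $W$ on every input and a node $W^{\mathsf T}$ on every output, where the wire from input $i$ to output $j$ has capacity $\min(a_i,b_j)$; * (h) for $b\le a$: $W:[a]\to[b]^{a+1}$ followed by $Z^b:[b]^{a+1}\to[b]$ equals $|0\rangle_b\otimes Z^a_0$, with $Z^a_0:[a]\to[\,]$; * ($\ell$) a self-loop on a spider $Z^1$ (capacity $1$) can be removed; * (i) for $b\le a$: $|1\rangle_b$ followed by $W^{\mathsf T}:[b]\to[a]$ equals $|1\rangle_a$; * (u) $Z^a:[\,]\to[a]$ equals $\frac1{a!}\cdot(\mathrm{id}\otimes\lambda_a)\circ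 W\circ|a\rangle_a$ with $W:[a]\to[a,a]$. Write $\mathrm{ZW}_d\vdash D_1=D_2$, respectively $\mathrm{ZW}_f\vdash D_1=D_2$, if $D_1$ can be turned into $D_2$ by applying these equations, in either direction, to parts of diagrams. Let $\iota_d$ be the map from $\mathrm{ZW}_d$-diagrams to $\mathrm{ZW}_f$-diagrams that annotates every wire with the capacity $d-1$. **Proposition.** For every $d\ge2$, all $n,m\geq 0$ and all $\mathrm{ZW}_d$-diagrams $D_1,D_2:n\to m$, $$\mathrm{ZW}_d\vdash D_1=D_2\quad\Longrightarrow\quad \mathrm{ZW}_f\vdash\iota_d(D_1)=\iota_d(D_2).$$ -/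

import Mathlib

/-!
Diagrams of the ZW-calculus, the qudit theory `ZW_d`, the mixed-dimensional theory `ZW_f`
and the embedding of the former into the latter.

Both languages share one syntax.  A diagram is a term whose wires carry labels in a type `C`:
* for `ZW_d` there is a single kind of wire, `C = Unit`, so a list of labels is just a number;
* for `ZW_f` a wire is labelled by its capacity `a ≥ 1` (its dimension minus one), `C = ℕ+`.
-/

namespace ZW

/-- Raw diagrams with wire labels in `C`.  `Z a r n m` is the Z-spider with `n` inputs, `m` outputs
and parameter `r`, all its wires being labelled `a`; `W a bs` is the W-node with input `a` and
outputs `bs`; `ketOne a` is the state `|1⟩` on a wire `a`; `scalar r` is the global scalar `r`.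
`comp D E` is the sequential composition "first `D`, then `E`". -/
inductive Diagram (C : Type) : Type
  | idn (l : List C)
  | comp (D E : Diagram C)
  | tensor (D E : Diagram C)
  | swap (a b : C)
  | cup (a : C)
  | cap (a : C)
  | Z (a : C) (r : ℂ) (n m : ℕ)
  | W (a : C) (bs : List C)
  | ketOne (a : C)
  | scalar (r : ℂ)

infixl:60 " ⨾ " => Diagram.comp
infixl:70 " ⊠ " => Diagram.tensor

open Diagram

/-- `HasType D l l'`: the raw term `D` is a diagram with inputs `l` and outputs `l'`.  The outputs of
a W-node may not exceed its input (no condition when there is only one label). -/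
inductive HasType {C : Type} [LE C] : Diagram C → List C → List C → Prop
  | idn (l : List C) : HasType (idn l) l l
  | comp {D E : Diagram C} {l m k : List C} :
      HasType D l m → HasType E m k → HasType (D ⨾ E) l k
  | tensor {D E : Diagram C} {l l' k k' : List C} :
      HasType D l l' → HasType E k k' → HasType (D ⊠ E) (l ++ k) (l' ++ k')
  | swap (a b : C) : HasType (swap a b) [a, b] [b, a]
  | cup (a : C) : HasType (cup a) [a, a] []
  | cap (a : C) : HasType (cap a) [] [a, a]
  | Z (a : C) (r : ℂ) (n m : ℕ) :
      HasType (Z a r n m) (List.replicate n a) (List.replicate m a)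
  | W (a : C) (bs : List C) : (∀ b ∈ bs, b ≤ a) → HasType (W a bs) [a] bs
  | ketOne (a : C) : HasType (ketOne a) [] [a]
  | scalar (r : ℂ) : HasType (scalar r) [] []

/-! ### Derived diagrams -/

section Derived

variable {C : Type}

/-- Moves one wire `a` past the wires `k`. -/
def braidOne (a : C) : List C → Diagram C
  | [] => idn [a]
  | b :: k => (swap a b ⊠ idn k) ⨾ (idn [b] ⊠ braidOne a k)

/-- The symmetry `l ++ k → k ++ l`. -/
def braid : List C → List C → Diagram C
  | [], k => idn k
  | a :: l, k => (idn [a] ⊠ braid l k) ⨾ (braidOne a k ⊠ idn l)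

/-- Nested cups `l ++ l.reverse → []`. -/
def nestedCup : List C → Diagram C
  | [] => idn []
  | a :: l => (idn [a] ⊠ nestedCup l ⊠ idn [a]) ⨾ cup a

/-- The upside-down W-node `bs → [a]`, obtained from a W-node by bending its wires.  The outputs of
W-nodes commute, so that the reversal caused by the planar bending is harmless. -/
def coW (bs : List C) (a : C) : Diagram C :=
  (idn bs ⊠ cap a) ⨾ (idn bs ⊠ W a bs.reverse ⊠ idn [a]) ⨾ (nestedCup bs ⊠ idn [a])

/-- The states `|k⟩` (interpreted as `√k! |k⟩`): `|0⟩` is the upside-down W-node without inputs,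
`|1⟩` is a generator, and `|k+1⟩` merges `|k⟩` and `|1⟩` in an upside-down W-node. -/
def ket (a : C) : ℕ → Diagram C
  | 0 => coW [] a
  | 1 => ketOne a
  | k + 2 => (ket a (k + 1) ⊠ ketOne a) ⨾ coW [a, a] a

/-- Parallel composition of a list of diagrams. -/
def tensorList : List (Diagram C) → Diagram C
  | [] => idn []
  | D :: Ds => D ⊠ tensorList Ds

/-- For pairs `(x₁, Y₁), …, (xₙ, Yₙ)`, the wiring
`[x₁, …, xₙ] ++ Y₁ ++ … ++ Yₙ → (x₁ :: Y₁) ++ … ++ (xₙ :: Yₙ)`. -/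
def gather : List (C × List C) → Diagram C
  | [] => idn []
  | (x, Y) :: ps =>
      (idn [x] ⊠ braid (ps.map Prod.fst) Y ⊠ idn (ps.flatMap Prod.snd)) ⨾
        (idn (x :: Y) ⊠ gather ps)

/-- For a matrix of wires `ℓ i j` (`i` in `is`, `j` in `js`), the permutation of wires from the
row by row enumeration to the column by column enumeration. -/
def transpose {I J : Type} (ℓ : I → J → C) : List I → List J → Diagram C
  | [], _ => idn []
  | i :: is, js =>
      (idn (js.map (ℓ i)) ⊠ transpose ℓ is js) ⨾
        gather (js.map fun j => (ℓ i j, is.map fun i' => ℓ i' j))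

/-- `restrict as b : as → as`.  Each wire is copied by a Z-spider; the first copies are the outputs,
the second copies are merged into one wire `b` by an upside-down W-node, and that wire is erased by
a Z-spider. -/
def restrict (as : List C) (b : C) : Diagram C :=
  tensorList (as.map fun a => Z a 1 1 2) ⨾
    transpose (fun a (_ : Bool) => a) as [false, true] ⨾
      (idn as ⊠ (coW as b ⨾ Z b 1 1 0))

/-- The state `|k⟩` is distributed over two wires, the second of which ends in a Z-spider with a
self-loop. -/
def splitAndLoop (a : C) (k : ℕ) : Diagram C :=
  ket a k ⨾ W a [a, a] ⨾ (idn [a] ⊠ (Z a 1 1 2 ⨾ cup a))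

end Derived

/-! ### Equational reasoning -/

/-- The laws of a strict symmetric monoidal category with a compact structure. -/
inductive Structural {C : Type} [LE C] : Diagram C → Diagram C → Prop
  | comp_assoc (D E F : Diagram C) : Structural (D ⨾ E ⨾ F) (D ⨾ (E ⨾ F))
  | id_comp (l : List C) (D : Diagram C) : Structural (idn l ⨾ D) D
  | comp_id (l : List C) (D : Diagram C) : Structural (D ⨾ idn l) D
  | tensor_assoc (D E F : Diagram C) : Structural (D ⊠ E ⊠ F) (D ⊠ (E ⊠ F))
  | nil_tensor (D : Diagram C) : Structural (idn [] ⊠ D) D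
  | tensor_nil (D : Diagram C) : Structural (D ⊠ idn []) D
  | id_tensor (l k : List C) : Structural (idn l ⊠ idn k) (idn (l ++ k))
  | interchange (D D' E E' : Diagram C) :
      Structural ((D ⨾ D') ⊠ (E ⨾ E')) ((D ⊠ E) ⨾ (D' ⊠ E'))
  | swap_swap (a b : C) : Structural (swap a b ⨾ swap b a) (idn [a, b])
  | naturality {D E : Diagram C} {l l' k k' : List C} :
      HasType D l l' → HasType E k k' →
        Structural ((D ⊠ E) ⨾ braid l' k') (braid l k ⨾ (E ⊠ D))
  | cap_swap (a : C) : Structural (cap a ⨾ swap a a) (cap a)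
  | snake_left (a : C) :
      Structural ((idn [a] ⊠ cap a) ⨾ (cup a ⊠ idn [a])) (idn [a])
  | snake_right (a : C) :
      Structural ((cap a ⊠ idn [a]) ⨾ (idn [a] ⊠ cup a)) (idn [a])

/-- The conventional equations on the topology of the generators.  The Z-spider is flexsymmetric:
its legs may be bent and permuted.  The outputs of the W-node may be permuted.  Permutations are
generated by exchanges of two neighbouring wires. -/
inductive Topological {C : Type} : Diagram C → Diagram C → Prop
  | Z_bend (a : C) (r : ℂ) (n m : ℕ) :
      Topological (Z a r (n + 1) m)
        ((idn [a] ⊠ Z a r n (m + 1)) ⨾ (cup a ⊠ idn (List.replicate m a)))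
  | Z_swap (a : C) (r : ℂ) (i j : ℕ) :
      Topological
        (Z a r 0 (i + 2 + j) ⨾
          (idn (List.replicate i a) ⊠ swap a a ⊠ idn (List.replicate j a)))
        (Z a r 0 (i + 2 + j))
  | W_swap (a b c : C) (l l' : List C) :
      Topological (W a (l ++ b :: c :: l') ⨾ (idn l ⊠ swap b c ⊠ idn l'))
        (W a (l ++ c :: b :: l'))

/-- The axioms that `ZW_d` and `ZW_f` have in common, up to the labels on the wires. -/
inductive CommonAxiom {C : Type} : Diagram C → Diagram C → Prop
  /-- (s): Z-spiders joined by one wire fuse. -/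
  | s (a : C) (r r' : ℂ) (n m n' m' : ℕ) :
      CommonAxiom
        ((Z a r n (m + 1) ⊠ idn (List.replicate n' a)) ⨾
          (idn (List.replicate m a) ⊠ Z a r' (n' + 1) m'))
        (Z a (r * r') (n + n') (m + m'))
  /-- (id): a W-node from a wire to a wire with the same label is the identity. -/
  | id (a : C) : CommonAxiom (W a [a]) (idn [a])
  /-- (b₁): bialgebra between Z-spider and W-node. -/
  | b₁ (a : C) (r : ℂ) (n : ℕ) (bs : List C) : n ≠ 0 →
      CommonAxiom
        (Z a r n 1 ⨾ W a bs)
        (tensorList (List.replicate n (W a bs)) ⨾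
          transpose (fun (_ : Unit) b => b) (List.replicate n ()) bs ⨾
            tensorList (bs.map fun b => Z b r n 1))
  /-- (+): sum of the parameters of two Z-spiders `0 → 1`. -/
  | sum (a : C) (r r' : ℂ) :
      CommonAxiom ((Z a r 0 1 ⊠ Z a r' 0 1) ⨾ coW [a, a] a) (Z a (r + r') 0 1)
  /-- (cp): a Z-spider copies `|1⟩`. -/
  | cp (a : C) (r : ℂ) (n : ℕ) :
      CommonAxiom (ketOne a ⨾ Z a r 1 n)
        (scalar r ⊠ tensorList (List.replicate n (ketOne a)))

/-- The remaining axioms of `ZW_d`. -/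
inductive QuditAxiom (d : ℕ) : Diagram Unit → Diagram Unit → Prop
  /-- (a): associativity of the W-node. -/
  | a (l bs l' : List Unit) :
      QuditAxiom d (W () (l ++ () :: l') ⨾ (idn l ⊠ W () bs ⊠ idn l')) (W () (l ++ bs ++ l'))
  /-- (h): Hopf rule, with `d` parallel wires. -/
  | h : QuditAxiom d
      (W () (List.replicate d ()) ⨾ Z () 1 d 1) (Z () 0 1 0 ⊠ ket () 0)
  /-- (b₂): bialgebra between W-nodes, in a context. -/
  | b₂ (as bs : List Unit) :
      QuditAxiom d
        (coW as () ⨾ W () bs)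
        (restrict as () ⨾
          (tensorList (as.map fun _ => W () bs) ⨾
            transpose (fun _ _ => ()) as bs ⨾
              tensorList (bs.map fun _ => coW as ())))
  /-- (e): erasing a `|k⟩`. -/
  | e (k : ℕ) : k < d → QuditAxiom d (ket () k ⨾ Z () 1 1 0) (idn [])
  /-- (ℓ): removal of a loop between Z-spiders, in a context. -/
  | loop : QuditAxiom d
      (ketOne () ⨾ W () [(), ()] ⨾ (idn [()] ⊠ (Z () 1 1 2 ⨾ Z () 1 2 1)))
      (ketOne () ⨾ W () [(), ()])
  /-- (u): decomposition of the Z-spider `0 → 1`. -/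
  | u : QuditAxiom d (Z () 1 0 1)
      (scalar (1 / ((d - 1).factorial : ℂ)) ⊠ splitAndLoop () (d - 1))

/-- The sum of a list of capacities. -/
def total (as : List ℕ+) : ℕ := (as.map fun a => (a : ℕ)).sum

/-- The remaining axioms of `ZW_f`. -/
inductive QufiniteAxiom : Diagram ℕ+ → Diagram ℕ+ → Prop
  /-- (a): associativity of the W-node, when the inner capacity `b` is large enough. -/
  | a (c b : ℕ+) (l as l' : List ℕ+) : b = c ∨ total as ≤ b →
      QufiniteAxiom (W c (l ++ b :: l') ⨾ (idn l ⊠ W b as ⊠ idn l')) (W c (l ++ as ++ l'))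
  /-- (o): associativity of the W-node for arbitrary capacities. -/
  | o (c b : ℕ+) (as : List ℕ+) :
      QufiniteAxiom (W c [b] ⨾ W b as) (W c as ⨾ restrict as b)
  /-- (b₂): bialgebra between W-nodes. -/
  | b₂ (c : ℕ+) (as bs : List ℕ+) : min (total as) (total bs) ≤ c →
      QufiniteAxiom
        (coW as c ⨾ W c bs)
        (tensorList (as.map fun a => W a (bs.map fun b => min a b)) ⨾
          transpose (fun a b => min a b) as bs ⨾
            tensorList (bs.map fun b => coW (as.map fun a => min a b) b))
  /-- (h): Hopf rule, with `a + 1` parallel wires. -/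
  | h (a b : ℕ+) :
      QufiniteAxiom
        (W a (List.replicate (a + 1) b) ⨾ Z b 1 (a + 1) 1) (Z a 0 1 0 ⊠ ket b 0)
  /-- (ℓ): a self-loop on a Z-spider of capacity `1` can be removed. -/
  | loop (n m : ℕ) :
      QufiniteAxiom
        (Z 1 1 n (m + 2) ⨾ (idn (List.replicate m 1) ⊠ cup 1)) (Z 1 1 n m)
  /-- (i): `|1⟩`, injected into a wire of larger capacity, is `|1⟩`. -/
  | i (a b : ℕ+) : QufiniteAxiom (ketOne b ⨾ coW [b] a) (ketOne a)
  /-- (u): decomposition of the Z-spider `0 → 1`. -/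
  | u (a : ℕ+) : QufiniteAxiom (Z a 1 0 1)
      (scalar (1 / ((a : ℕ).factorial : ℂ)) ⊠ splitAndLoop a a)

/-- `Derivable R l l' D E`: the equation `D = E` between diagrams with inputs `l` and outputs `l'`
follows from the structural and topological laws, the axioms common to both theories, and the axioms
`R`, by equational reasoning through well-typed diagrams. -/
inductive Derivable {C : Type} [LE C] (R : Diagram C → Diagram C → Prop) :
    List C → List C → Diagram C → Diagram C → Prop
  | refl {l l' : List C} {D : Diagram C} : HasType D l l' → Derivable R l l' D D
  | symm {l l' : List C} {D E : Diagram C} : Derivable R l l' D E → Derivable R l l' E D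
  | trans {l l' : List C} {D E F : Diagram C} :
      Derivable R l l' D E → Derivable R l l' E F → Derivable R l l' D F
  | comp {l m k : List C} {D D' E E' : Diagram C} :
      Derivable R l m D D' → Derivable R m k E E' → Derivable R l k (D ⨾ E) (D' ⨾ E')
  | tensor {l l' k k' : List C} {D D' E E' : Diagram C} :
      Derivable R l l' D D' → Derivable R k k' E E' →
        Derivable R (l ++ k) (l' ++ k') (D ⊠ E) (D' ⊠ E')
  | ax {l l' : List C} {D E : Diagram C} :
      Structural D E ∨ Topological D E ∨ CommonAxiom D E ∨ R D E →
        HasType D l l' → HasType E l l' → Derivable R l l' D E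

/-- `ZW_d ⊢ D = E`, for diagrams `D E : n → m`. -/
def QuditDerives (d n m : ℕ) (D E : Diagram Unit) : Prop :=
  Derivable (QuditAxiom d) (List.replicate n ()) (List.replicate m ()) D E

/-- `ZW_f ⊢ D = E`, for diagrams `D E : l → l'`. -/
def QufiniteDerives (l l' : List ℕ+) (D E : Diagram ℕ+) : Prop :=
  Derivable QufiniteAxiom l l' D E

/-! ### The embedding -/

/-- Relabelling of all wires of a diagram. -/
def Diagram.relabel {C C' : Type} (f : C → C') : Diagram C → Diagram C'
  | idn l => idn (l.map f)
  | comp D E => comp (D.relabel f) (E.relabel f)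
  | tensor D E => tensor (D.relabel f) (E.relabel f)
  | swap a b => swap (f a) (f b)
  | cup a => cup (f a)
  | cap a => cap (f a)
  | Z a r n m => Z (f a) r n m
  | W a bs => W (f a) (bs.map f)
  | ketOne a => ketOne (f a)
  | scalar r => scalar r

/-- The capacity `d - 1` of a `d`-dimensional wire. -/
def capacity (d : ℕ) (hd : 2 ≤ d) : ℕ+ := ⟨d - 1, by omega⟩

/-- The embedding `ι_d`, which annotates every wire with the capacity `d - 1`. -/
def embed (d : ℕ) (hd : 2 ≤ d) : Diagram Unit → Diagram ℕ+ :=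
  Diagram.relabel fun _ => capacity d hd

end ZW

namespace ZW

open Diagram

/-! ### Domains and codomains -/

/-! Relabelling every wire by the capacity `c = d - 1` sends the structural, topological and common
laws to instances of themselves. Only the six remaining axioms of `ZW_d` have to be derived at
capacity `c`, and three of them are instances of their namesakes: (a) with equal inner and outer
capacity, (h) with both capacities `c`, and (u).

(e): for `k ≥ 1` the state `|k⟩` is copied by the Z-spider, so it absorbs the scalar `ε ∘ |k⟩`. For
`k ≤ c` the state `|c⟩` is built from `|k⟩` and absorbs this scalar too, and by (u) so does the
Z-state. Closing with `W : [c] → []`, which turns the Z-state into the empty diagram, shows that the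
scalar is trivial (`ket_erase`).

(ℓ): by (i), `|1⟩` on the wire `c` is injected from a wire of capacity 1. The injection commutes
with W-nodes, copying and merging, so the loop slides to capacity 1, where it can be removed
(`ketOne_W_loop`).

(b₂): the middle wire is in general too small for the (b₂) of `ZW_f`, so it is passed through a wire
of much larger capacity, where (b₂) holds without a restriction. The price of the detour is axiom
(o) read upside down, which produces exactly the diagram `restrict` (`coW_inject`,
`coW_W_restrict`). Reading equations upside down is made precise by mates (`IsMate`); the bialgebra
law (b₁) moves the restriction through the W-node.

The calculations take place in the quotient `Cls` of raw diagrams. A planar deformation is checked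
there by rewriting both sides into sequences of one-generator layers in a fixed order. -/

/-- The inputs of a raw diagram. -/
def Diagram.dom {C : Type} : Diagram C → List C
  | idn l => l
  | comp D _ => D.dom
  | tensor D E => D.dom ++ E.dom
  | swap a b => [a, b]
  | cup a => [a, a]
  | cap _ => []
  | Z a _ n _ => List.replicate n a
  | W a _ => [a]
  | ketOne _ => []
  | scalar _ => []

/-- The outputs of a raw diagram. -/
def Diagram.cod {C : Type} : Diagram C → List C
  | idn l => l
  | comp _ E => E.cod
  | tensor D E => D.cod ++ E.cod
  | swap a b => [b, a]
  | cup _ => []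
  | cap a => [a, a]
  | Z a _ _ m => List.replicate m a
  | W _ bs => bs
  | ketOne a => [a]
  | scalar _ => []

section Typing

variable {C : Type} [LE C]

theorem HasType.dom_eq {D : Diagram C} {l l' : List C} (h : HasType D l l') : D.dom = l := by
  induction h <;> simp_all [Diagram.dom]

theorem HasType.cod_eq {D : Diagram C} {l l' : List C} (h : HasType D l l') : D.cod = l' := by
  induction h <;> simp_all [Diagram.cod]

/-- A raw diagram is well typed if it has the type given by its inputs and outputs. -/
def Diagram.Typed (D : Diagram C) : Prop := HasType D D.dom D.cod

theorem HasType.typed {D : Diagram C} {l l' : List C} (h : HasType D l l') : D.Typed := by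
  unfold Diagram.Typed
  rwa [h.dom_eq, h.cod_eq]

theorem typed_idn (l : List C) : (idn l).Typed := HasType.idn l

theorem typed_comp {D E : Diagram C} : (D ⨾ E).Typed ↔ D.Typed ∧ E.Typed ∧ D.cod = E.dom := by
  constructor
  · intro h
    cases h with
    | comp h₁ h₂ => exact ⟨h₁.typed, h₂.typed, by rw [h₁.cod_eq, h₂.dom_eq]⟩
  · rintro ⟨h₁, h₂, h⟩
    refine HasType.comp h₁ ?_
    rw [h]
    exact h₂

theorem typed_tensor {D E : Diagram C} : (D ⊠ E).Typed ↔ D.Typed ∧ E.Typed := by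
  constructor
  · intro h
    unfold Diagram.Typed at h
    generalize (D ⊠ E).dom = l at h
    generalize (D ⊠ E).cod = l' at h
    cases h with
    | tensor h₁ h₂ => exact ⟨h₁.typed, h₂.typed⟩
  · rintro ⟨h₁, h₂⟩
    exact HasType.tensor h₁ h₂

theorem typed_W {a : C} {bs : List C} : (W a bs).Typed ↔ ∀ b ∈ bs, b ≤ a := by
  constructor
  · intro h
    cases h with
    | W _ _ h => exact h
  · exact HasType.W a bs

theorem typed_swap (a b : C) : (swap a b).Typed := HasType.swap a b
theorem typed_cup (a : C) : (cup a).Typed := HasType.cup a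
theorem typed_cap (a : C) : (cap a).Typed := HasType.cap a
theorem typed_Z (a : C) (r : ℂ) (n m : ℕ) : (Z a r n m).Typed := HasType.Z a r n m
theorem typed_ketOne (a : C) : (ketOne a).Typed := HasType.ketOne a
theorem typed_scalar (r : ℂ) : (scalar (C := C) r).Typed := HasType.scalar r

end Typing

/-! ### Diagrams of `ZW_f` up to derivable equality -/

/-- Equality of raw diagrams that is derivable in `ZW_f`; ill-typed diagrams with the same inputs and
the same outputs are identified with each other. -/
def Equivalent (D E : Diagram ℕ+) : Prop :=
  D.dom = E.dom ∧ D.cod = E.cod ∧ (D.Typed ↔ E.Typed) ∧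
    (D.Typed → QufiniteDerives D.dom D.cod D E)

theorem Equivalent.refl (D : Diagram ℕ+) : Equivalent D D :=
  ⟨rfl, rfl, Iff.rfl, fun h => Derivable.refl h⟩

theorem Equivalent.symm {D E : Diagram ℕ+} (h : Equivalent D E) : Equivalent E D := by
  obtain ⟨h₁, h₂, h₃, h₄⟩ := h
  refine ⟨h₁.symm, h₂.symm, h₃.symm, fun h => ?_⟩
  rw [← h₁, ← h₂]
  exact Derivable.symm (h₄ (h₃.2 h))

theorem Equivalent.trans {D E F : Diagram ℕ+} (h : Equivalent D E) (k : Equivalent E F) :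
    Equivalent D F := by
  obtain ⟨h₁, h₂, h₃, h₄⟩ := h
  obtain ⟨k₁, k₂, k₃, k₄⟩ := k
  refine ⟨h₁.trans k₁, h₂.trans k₂, h₃.trans k₃, fun h => Derivable.trans (h₄ h) ?_⟩
  rw [h₁, h₂]
  exact k₄ (h₃.1 h)

instance equivalentSetoid : Setoid (Diagram ℕ+) :=
  ⟨Equivalent, Equivalent.refl, Equivalent.symm, Equivalent.trans⟩

theorem Equivalent.comp {D D' E E' : Diagram ℕ+} (h : Equivalent D D') (k : Equivalent E E') :
    Equivalent (D ⨾ E) (D' ⨾ E') := by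
  obtain ⟨h₁, h₂, h₃, h₄⟩ := h
  obtain ⟨k₁, k₂, k₃, k₄⟩ := k
  refine ⟨h₁, k₂, ?_, fun h => ?_⟩
  · rw [typed_comp, typed_comp, h₃, k₃, h₂, k₁]
  · obtain ⟨h, k, e⟩ := typed_comp.1 h
    refine Derivable.comp (h₄ h) ?_
    rw [e]
    exact k₄ k

theorem Equivalent.tensor {D D' E E' : Diagram ℕ+} (h : Equivalent D D') (k : Equivalent E E') :
    Equivalent (D ⊠ E) (D' ⊠ E') := by
  obtain ⟨h₁, h₂, h₃, h₄⟩ := h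
  obtain ⟨k₁, k₂, k₃, k₄⟩ := k
  refine ⟨by simp [Diagram.dom, h₁, k₁], by simp [Diagram.cod, h₂, k₂], ?_, fun h => ?_⟩
  · rw [typed_tensor, typed_tensor, h₃, k₃]
  · obtain ⟨h, k⟩ := typed_tensor.1 h
    exact Derivable.tensor (h₄ h) (k₄ k)

/-- Diagrams of `ZW_f` up to derivable equality. -/
def Cls : Type := Quotient equivalentSetoid

/-- The class of a diagram. -/
def cls (D : Diagram ℕ+) : Cls := Quotient.mk _ D

namespace Cls

def comp : Cls → Cls → Cls :=
  Quotient.map₂ Diagram.comp fun _ _ h _ _ k => Equivalent.comp h k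

def tensor : Cls → Cls → Cls :=
  Quotient.map₂ Diagram.tensor fun _ _ h _ _ k => Equivalent.tensor h k

def dom : Cls → List ℕ+ := Quotient.lift Diagram.dom fun _ _ h => h.1

def cod : Cls → List ℕ+ := Quotient.lift Diagram.cod fun _ _ h => h.2.1

/-- The identity diagram. -/
def one (l : List ℕ+) : Cls := cls (idn l)

end Cls

infixr:60 " ⟫ " => Cls.comp
infixr:70 " ⊗ᶜ " => Cls.tensor

open Cls

@[simp] theorem cls_comp (D E : Diagram ℕ+) : cls (D ⨾ E) = cls D ⟫ cls E := rfl
@[simp] theorem cls_tensor (D E : Diagram ℕ+) : cls (D ⊠ E) = cls D ⊗ᶜ cls E := rfl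
@[simp] theorem cls_idn (l : List ℕ+) : cls (idn l) = one l := rfl

theorem dom_cls (D : Diagram ℕ+) : (cls D).dom = D.dom := rfl
theorem cod_cls (D : Diagram ℕ+) : (cls D).cod = D.cod := rfl

@[simp] theorem dom_comp (D E : Cls) : (D ⟫ E).dom = D.dom := by
  induction D using Quotient.ind; induction E using Quotient.ind; rfl
@[simp] theorem cod_comp (D E : Cls) : (D ⟫ E).cod = E.cod := by
  induction D using Quotient.ind; induction E using Quotient.ind; rfl
@[simp] theorem dom_tensor (D E : Cls) : (D ⊗ᶜ E).dom = D.dom ++ E.dom := by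
  induction D using Quotient.ind; induction E using Quotient.ind; rfl
@[simp] theorem cod_tensor (D E : Cls) : (D ⊗ᶜ E).cod = D.cod ++ E.cod := by
  induction D using Quotient.ind; induction E using Quotient.ind; rfl
@[simp] theorem dom_one (l : List ℕ+) : (one l).dom = l := (rfl)
@[simp] theorem cod_one (l : List ℕ+) : (one l).cod = l := (rfl)
@[simp] theorem dom_swap (a b : ℕ+) : (cls (swap a b)).dom = [a, b] := (rfl)
@[simp] theorem cod_swap (a b : ℕ+) : (cls (swap a b)).cod = [b, a] := (rfl)
@[simp] theorem dom_cup (a : ℕ+) : (cls (cup a)).dom = [a, a] := (rfl)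
@[simp] theorem cod_cup (a : ℕ+) : (cls (cup a)).cod = [] := (rfl)
@[simp] theorem dom_cap (a : ℕ+) : (cls (cap a)).dom = [] := (rfl)
@[simp] theorem cod_cap (a : ℕ+) : (cls (cap a)).cod = [a, a] := (rfl)
@[simp] theorem dom_Z (a : ℕ+) (r : ℂ) (n m : ℕ) :
    (cls (Z a r n m)).dom = List.replicate n a := (rfl)
@[simp] theorem cod_Z (a : ℕ+) (r : ℂ) (n m : ℕ) :
    (cls (Z a r n m)).cod = List.replicate m a := (rfl)
@[simp] theorem dom_W (a : ℕ+) (bs : List ℕ+) : (cls (W a bs)).dom = [a] := (rfl)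
@[simp] theorem cod_W (a : ℕ+) (bs : List ℕ+) : (cls (W a bs)).cod = bs := (rfl)
@[simp] theorem dom_ketOne (a : ℕ+) : (cls (ketOne a)).dom = [] := (rfl)
@[simp] theorem cod_ketOne (a : ℕ+) : (cls (ketOne a)).cod = [a] := (rfl)
@[simp] theorem dom_scalar (r : ℂ) : (cls (scalar r)).dom = [] := (rfl)
@[simp] theorem cod_scalar (r : ℂ) : (cls (scalar r)).cod = [] := (rfl)

/-- Equality of classes is derivable equality. -/
theorem derives_of_cls_eq {l l' : List ℕ+} {D E : Diagram ℕ+} (hD : HasType D l l')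
    (h : cls D = cls E) : QufiniteDerives l l' D E := by
  have := (Quotient.exact h : Equivalent D E).2.2.2 hD.typed
  rwa [hD.dom_eq, hD.cod_eq] at this

/-- An axiom gives an equality of classes only if its two sides are well typed simultaneously. This
is the origin of the capacity hypotheses in the class versions of the axioms. -/
theorem cls_eq_of_typed {D E : Diagram ℕ+}
    (h : Structural D E ∨ Topological D E ∨ CommonAxiom D E ∨ QufiniteAxiom D E)
    (hd : D.dom = E.dom) (hc : D.cod = E.cod) (ht : D.Typed ↔ E.Typed) : cls D = cls E := by
  refine Quotient.sound ⟨hd, hc, ht, fun h₁ => Derivable.ax h h₁ ?_⟩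
  rw [hd, hc]
  exact ht.1 h₁

/-! ### The laws of a strict monoidal category -/

theorem comp_assoc (D E F : Cls) : (D ⟫ E) ⟫ F = D ⟫ E ⟫ F := by
  induction D using Quotient.ind; induction E using Quotient.ind; induction F using Quotient.ind
  refine cls_eq_of_typed (.inl (.comp_assoc _ _ _)) rfl rfl ?_
  simp only [typed_comp, Diagram.dom, Diagram.cod]
  tauto

theorem tensor_assoc (D E F : Cls) : (D ⊗ᶜ E) ⊗ᶜ F = D ⊗ᶜ E ⊗ᶜ F := by
  induction D using Quotient.ind; induction E using Quotient.ind; induction F using Quotient.ind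
  refine cls_eq_of_typed (.inl (.tensor_assoc _ _ _)) (by simp [Diagram.dom])
    (by simp [Diagram.cod]) ?_
  simp only [typed_tensor]
  tauto

theorem one_comp' {l : List ℕ+} {D : Cls} (h : D.dom = l) : one l ⟫ D = D := by
  subst h
  induction D using Quotient.ind
  refine cls_eq_of_typed (.inl (.id_comp _ _)) rfl rfl ?_
  simp only [typed_comp, typed_idn, Diagram.cod, Cls.dom]
  tauto

theorem comp_one' {l : List ℕ+} {D : Cls} (h : D.cod = l) : D ⟫ one l = D := by
  subst h
  induction D using Quotient.ind
  refine cls_eq_of_typed (.inl (.comp_id _ _)) rfl rfl ?_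
  simp only [typed_comp, typed_idn, Diagram.dom, Cls.cod]
  tauto

@[simp] theorem one_nil_tensor (D : Cls) : one [] ⊗ᶜ D = D := by
  induction D using Quotient.ind
  refine cls_eq_of_typed (.inl (.nil_tensor _)) rfl rfl ?_
  simp [typed_tensor, typed_idn]

@[simp] theorem tensor_one_nil (D : Cls) : D ⊗ᶜ one [] = D := by
  induction D using Quotient.ind
  refine cls_eq_of_typed (.inl (.tensor_nil _)) (by simp [Diagram.dom]) (by simp [Diagram.cod]) ?_
  simp [typed_tensor, typed_idn]

theorem one_tensor_one (l k : List ℕ+) : one l ⊗ᶜ one k = one (l ++ k) := by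
  refine cls_eq_of_typed (.inl (.id_tensor _ _)) rfl rfl ?_
  simp [typed_tensor, typed_idn]

/-- The boundary conditions cannot be dropped: the concatenated boundaries may agree although the
individual factors do not compose. -/
theorem interchange {D D' E E' : Cls} (h : D.cod = D'.dom) (k : E.cod = E'.dom) :
    (D ⊗ᶜ E) ⟫ (D' ⊗ᶜ E') = (D ⟫ D') ⊗ᶜ (E ⟫ E') := by
  induction D using Quotient.ind; induction E using Quotient.ind
  induction D' using Quotient.ind; induction E' using Quotient.ind
  symm
  refine cls_eq_of_typed (.inl (.interchange _ _ _ _)) rfl rfl ?_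
  simp only [typed_comp, typed_tensor, Diagram.dom, Diagram.cod]
  have h' : Diagram.cod _ = Diagram.dom _ := h
  have k' : Diagram.cod _ = Diagram.dom _ := k
  simp only [h', k']
  tauto

theorem tensor_eq_comp (D E : Cls) :
    D ⊗ᶜ E = (D ⊗ᶜ one E.dom) ⟫ (one D.cod ⊗ᶜ E) := by
  rw [interchange (by simp) (by simp), one_comp' rfl, comp_one' rfl]

theorem tensor_eq_comp' (D E : Cls) :
    D ⊗ᶜ E = (one D.dom ⊗ᶜ E) ⟫ (D ⊗ᶜ one E.cod) := by
  rw [interchange (by simp) (by simp), one_comp' rfl, comp_one' rfl]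

/-! ### Whiskering -/

/-- The diagram `D` with further wires `l` on its left and `r` on its right. -/
def whisk (l : List ℕ+) (D : Cls) (r : List ℕ+) : Cls := one l ⊗ᶜ D ⊗ᶜ one r

@[simp] theorem dom_whisk (l : List ℕ+) (D : Cls) (r : List ℕ+) :
    (whisk l D r).dom = l ++ (D.dom ++ r) := by simp [whisk]
@[simp] theorem cod_whisk (l : List ℕ+) (D : Cls) (r : List ℕ+) :
    (whisk l D r).cod = l ++ (D.cod ++ r) := by simp [whisk]

theorem whisk_comp (l : List ℕ+) (D E : Cls) (r : List ℕ+) :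
    whisk l (D ⟫ E) r = whisk l D r ⟫ whisk l E r := by
  by_cases h : D.cod = E.dom
  · unfold whisk
    rw [interchange (by simp) (by simp [h]), interchange h (by simp), one_comp' (by simp),
      one_comp' (by simp)]
  -- If the boundaries do not match, both sides are ill-typed with the same inputs and outputs, and
  -- such diagrams form a single class.
  · induction D using Quotient.ind; induction E using Quotient.ind
    have h' : ¬ Diagram.cod _ = Diagram.dom _ := h
    refine Quotient.sound ⟨by simp [Diagram.dom], by simp [Diagram.cod], ?_, fun t => ?_⟩
    · simp [typed_comp, typed_tensor, h', Diagram.dom, Diagram.cod]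
    · simp [typed_comp, typed_tensor, h'] at t

theorem whisk_tensor (l : List ℕ+) (D E : Cls) (r : List ℕ+) :
    whisk l (D ⊗ᶜ E) r = whisk l D (E.dom ++ r) ⟫ whisk (l ++ D.cod) E r := by
  conv_lhs => rw [tensor_eq_comp, whisk_comp]
  unfold whisk
  rw [tensor_assoc, one_tensor_one, ← one_tensor_one l, tensor_assoc, tensor_assoc]

theorem whisk_one (l k r : List ℕ+) : whisk l (one k) r = one (l ++ (k ++ r)) := by
  unfold whisk
  rw [one_tensor_one, one_tensor_one]

theorem whisk_whisk (l l' : List ℕ+) (D : Cls) (r' r : List ℕ+) :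
    whisk l (whisk l' D r') r = whisk (l ++ l') D (r' ++ r) := by
  unfold whisk
  rw [← one_tensor_one l, ← one_tensor_one r']
  simp only [tensor_assoc]

theorem whisk_nil (D : Cls) : whisk [] D [] = D := by simp [whisk]

/-- The entry point for planar deformations: `simp` pushes the outer whiskering down to the
generators, so that both sides become sequences of layers. -/
theorem eq_of_whisk {D E : Cls} (h : whisk [] D [] = whisk [] E []) : D = E := by
  rwa [whisk_nil, whisk_nil] at h

/-- Diagrams that are applied to different wires commute. -/
theorem whisk_exchange (l : List ℕ+) (D : Cls) (m : List ℕ+) (E : Cls) (r : List ℕ+) :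
    whisk (l ++ (D.dom ++ m)) E r ⟫ whisk l D (m ++ (E.cod ++ r)) =
      whisk l D (m ++ (E.dom ++ r)) ⟫ whisk (l ++ (D.cod ++ m)) E r := by
  have h₁ := whisk_tensor l D (one m ⊗ᶜ E) r
  have h₂ := whisk_comp l (one D.dom ⊗ᶜ (one m ⊗ᶜ E)) (D ⊗ᶜ one (m ++ E.cod)) r
  have h₃ := tensor_eq_comp' D (one m ⊗ᶜ E)
  simp only [whisk, cod_tensor, cod_one, dom_tensor, dom_one] at *
  rw [← h₃, h₁] at h₂
  simp only [← one_tensor_one, tensor_assoc] at h₂ ⊢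
  exact h₂.symm

theorem exchange_left {l₁ l₂ r₁ r₂ : List ℕ+} {D E : Cls} (m : List ℕ+)
    (h : l₁ = l₂ ++ (D.dom ++ m)) (k : r₂ = m ++ (E.cod ++ r₁)) :
    whisk l₁ E r₁ ⟫ whisk l₂ D r₂ =
      whisk l₂ D (m ++ (E.dom ++ r₁)) ⟫ whisk (l₂ ++ (D.cod ++ m)) E r₁ := by
  rw [h, k, whisk_exchange]

theorem exchange_left_assoc {l₁ l₂ r₁ r₂ : List ℕ+} {D E : Cls} (m : List ℕ+) (X : Cls)
    (h : l₁ = l₂ ++ (D.dom ++ m)) (k : r₂ = m ++ (E.cod ++ r₁)) :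
    whisk l₁ E r₁ ⟫ whisk l₂ D r₂ ⟫ X =
      whisk l₂ D (m ++ (E.dom ++ r₁)) ⟫ whisk (l₂ ++ (D.cod ++ m)) E r₁ ⟫ X := by
  rw [← comp_assoc, exchange_left m h k, comp_assoc]

attribute [simp] comp_assoc whisk_comp whisk_tensor whisk_one whisk_whisk one_comp' comp_one'

/-- The layer that acts further to the left is moved to the front. -/
theorem sort_layers {l₁ l₂ r₁ r₂ : List ℕ+} {D E : Cls}
    (h : l₂ ++ (D.dom ++ l₁.drop (l₂.length + D.dom.length)) = l₁)
    (k : l₁.drop (l₂.length + D.dom.length) ++ (E.cod ++ r₁) = r₂)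
    (_ : D.cod ++ (l₁.drop (l₂.length + D.dom.length) ++ E.dom) ≠ []) :
    whisk l₁ E r₁ ⟫ whisk l₂ D r₂ =
      whisk l₂ D (l₁.drop (l₂.length + D.dom.length) ++ (E.dom ++ r₁)) ⟫
        whisk (l₂ ++ (D.cod ++ l₁.drop (l₂.length + D.dom.length))) E r₁ :=
  exchange_left _ h.symm k.symm

/-- For use as a rewrite rule, the wires between the two generators are recovered by `drop`. The
last hypothesis excludes the only situation in which the exchanged layers match the rule again,
namely an effect directly beside a state, and so prevents looping. -/
theorem sort_layers_assoc {l₁ l₂ r₁ r₂ : List ℕ+} {D E : Cls} (X : Cls)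
    (h : l₂ ++ (D.dom ++ l₁.drop (l₂.length + D.dom.length)) = l₁)
    (k : l₁.drop (l₂.length + D.dom.length) ++ (E.cod ++ r₁) = r₂)
    (_ : D.cod ++ (l₁.drop (l₂.length + D.dom.length) ++ E.dom) ≠ []) :
    whisk l₁ E r₁ ⟫ whisk l₂ D r₂ ⟫ X =
      whisk l₂ D (l₁.drop (l₂.length + D.dom.length) ++ (E.dom ++ r₁)) ⟫
        whisk (l₂ ++ (D.cod ++ l₁.drop (l₂.length + D.dom.length))) E r₁ ⟫ X :=
  exchange_left_assoc _ X h.symm k.symm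

/-! ### Symmetry and compact structure -/

@[simp] theorem dom_braidOne (a : ℕ+) (k : List ℕ+) : (cls (braidOne a k)).dom = a :: k := by
  cases k <;> rfl

@[simp] theorem cod_braidOne (a : ℕ+) (k : List ℕ+) : (cls (braidOne a k)).cod = k ++ [a] := by
  induction k with
  | nil => rfl
  | cons b k ih => simp [braidOne, ih]

@[simp] theorem dom_braid (l k : List ℕ+) : (cls (braid l k)).dom = l ++ k := by
  induction l with
  | nil => rfl
  | cons a l ih => simp [braid, ih]

@[simp] theorem cod_braid (l k : List ℕ+) : (cls (braid l k)).cod = k ++ l := by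
  cases l <;> simp [braid]

theorem typed_braidOne (a : ℕ+) (k : List ℕ+) : (braidOne a k).Typed := by
  induction k with
  | nil => exact typed_idn _
  | cons b k ih =>
    simp only [braidOne, typed_comp, typed_tensor, typed_swap, typed_idn, ih, true_and]
    simp [← dom_cls, ← cod_cls]

theorem typed_braid (l k : List ℕ+) : (braid l k).Typed := by
  induction l with
  | nil => exact typed_idn _
  | cons a l ih =>
    simp only [braid, typed_comp, typed_tensor, typed_idn, typed_braidOne, ih, true_and]
    simp [← dom_cls, ← cod_cls]

@[simp] theorem braidOne_nil (a : ℕ+) : cls (braidOne a []) = one [a] := rfl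

@[simp] theorem braid_nil (k : List ℕ+) : cls (braid [] k) = one k := rfl

theorem braidOne_cons (a b : ℕ+) (k : List ℕ+) :
    cls (braidOne a (b :: k)) =
      (cls (swap a b) ⊗ᶜ one k) ⟫ (one [b] ⊗ᶜ cls (braidOne a k)) := rfl

theorem braid_cons (a : ℕ+) (l k : List ℕ+) :
    cls (braid (a :: l) k) =
      (one [a] ⊗ᶜ cls (braid l k)) ⟫ (cls (braidOne a k) ⊗ᶜ one l) := rfl

@[simp] theorem braid_nil_right (l : List ℕ+) : cls (braid l []) = one l := by
  induction l with
  | nil => rfl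
  | cons a l ih => simp [braid_cons, ih, one_tensor_one]

@[simp] theorem braidOne_singleton (a b : ℕ+) : cls (braidOne a [b]) = cls (swap a b) := by
  simp [braidOne_cons, one_tensor_one]

@[simp] theorem braid_singleton (a : ℕ+) (k : List ℕ+) :
    cls (braid [a] k) = cls (braidOne a k) := by
  simp [braid_cons, one_tensor_one]

theorem braid_natural (D E : Cls) :
    (D ⊗ᶜ E) ⟫ cls (braid D.cod E.cod) = cls (braid D.dom E.dom) ⟫ (E ⊗ᶜ D) := by
  induction D using Quotient.ind with | _ D
  induction E using Quotient.ind with | _ E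
  by_cases h : D.Typed ∧ E.Typed
  · refine cls_eq_of_typed (.inl (.naturality h.1 h.2)) ?_ ?_ ?_
    · exact (dom_braid D.dom E.dom).symm
    · exact cod_braid D.cod E.cod
    · simp only [typed_comp, typed_tensor, h, typed_braid, true_and, and_true]
      exact ⟨fun _ => cod_braid D.dom E.dom, fun _ => (dom_braid D.cod E.cod).symm⟩
  · refine Quotient.sound ⟨?_, ?_, ?_, fun t => ?_⟩
    · exact (dom_braid D.dom E.dom).symm
    · exact cod_braid D.cod E.cod
    · simp only [typed_comp, typed_tensor]
      tauto
    · simp only [typed_comp, typed_tensor] at t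
      tauto

theorem swap_swap (a b : ℕ+) : cls (swap a b) ⟫ cls (swap b a) = one [a, b] :=
  cls_eq_of_typed (.inl (.swap_swap a b)) rfl rfl
    (by simp [typed_comp, typed_swap, typed_idn, Diagram.dom, Diagram.cod])

theorem snake_left (a : ℕ+) :
    (one [a] ⊗ᶜ cls (cap a)) ⟫ (cls (cup a) ⊗ᶜ one [a]) = one [a] :=
  cls_eq_of_typed (.inl (.snake_left a)) rfl rfl
    (by simp [typed_comp, typed_tensor, typed_cup, typed_cap, typed_idn, Diagram.dom,
      Diagram.cod])

theorem snake_right (a : ℕ+) :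
    (cls (cap a) ⊗ᶜ one [a]) ⟫ (one [a] ⊗ᶜ cls (cup a)) = one [a] :=
  cls_eq_of_typed (.inl (.snake_right a)) rfl rfl
    (by simp [typed_comp, typed_tensor, typed_cup, typed_cap, typed_idn, Diagram.dom,
      Diagram.cod])

/-- A diagram is determined by the diagram in which its last output is bent to the inputs. -/
theorem bend_injective {D E : Cls} {u : List ℕ+} {a : ℕ+} (hD : D.cod = u ++ [a])
    (hE : E.cod = u ++ [a])
    (h : (D ⊗ᶜ one [a]) ⟫ (one u ⊗ᶜ cls (cup a)) = (E ⊗ᶜ one [a]) ⟫ (one u ⊗ᶜ cls (cup a)))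
    (hd : D.dom = E.dom) : D = E := by
  -- Bending the output back with a cap recovers the diagram, by a snake equation.
  have key : ∀ F : Cls, F.cod = u ++ [a] →
      (one F.dom ⊗ᶜ cls (cap a)) ⟫ (((F ⊗ᶜ one [a]) ⟫ (one u ⊗ᶜ cls (cup a))) ⊗ᶜ one [a]) = F := by
    intro F hF
    have e : F ⟫ (one u ⊗ᶜ ((one [a] ⊗ᶜ cls (cap a)) ⟫ (cls (cup a) ⊗ᶜ one [a]))) = F := by
      rw [snake_left, one_tensor_one, comp_one' hF]
    refine Eq.trans ?_ e
    refine eq_of_whisk ?_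
    simp [sort_layers_assoc, hF]
  rw [← key D hD, ← key E hE, h, hd]

attribute [simp] sort_layers sort_layers_assoc

/-! ### Types of the derived diagrams -/

section DerivedTypes

@[simp] theorem dom_nestedCup (l : List ℕ+) : (cls (nestedCup l)).dom = l ++ l.reverse := by
  induction l with
  | nil => rfl
  | cons a l ih => simp [nestedCup, ih]

@[simp] theorem cod_nestedCup (l : List ℕ+) : (cls (nestedCup l)).cod = [] := by
  cases l <;> simp [nestedCup]

theorem typed_nestedCup (l : List ℕ+) : (nestedCup l).Typed := by
  induction l with
  | nil => exact typed_idn _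
  | cons a l ih =>
    simp only [nestedCup, typed_comp, typed_tensor, typed_idn, typed_cup, ih, true_and]
    simp [← dom_cls, ← cod_cls]

@[simp] theorem dom_coW (bs : List ℕ+) (a : ℕ+) : (cls (coW bs a)).dom = bs := by
  simp [coW]

@[simp] theorem cod_coW (bs : List ℕ+) (a : ℕ+) : (cls (coW bs a)).cod = [a] := by
  simp [coW]

theorem typed_coW {bs : List ℕ+} {a : ℕ+} : (coW bs a).Typed ↔ ∀ b ∈ bs, b ≤ a := by
  simp only [coW, typed_comp, typed_tensor, typed_idn, typed_cap, typed_nestedCup, typed_W,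
    true_and, and_true]
  simp [← dom_cls, ← cod_cls]

theorem dom_tensorList (Ds : List (Diagram ℕ+)) :
    (cls (tensorList Ds)).dom = Ds.flatMap fun D => D.dom := by
  induction Ds with
  | nil => rfl
  | cons D Ds ih => simp [tensorList, ih, dom_cls]

theorem cod_tensorList (Ds : List (Diagram ℕ+)) :
    (cls (tensorList Ds)).cod = Ds.flatMap fun D => D.cod := by
  induction Ds with
  | nil => rfl
  | cons D Ds ih => simp [tensorList, ih, cod_cls]

theorem typed_tensorList (Ds : List (Diagram ℕ+)) :
    (tensorList Ds).Typed ↔ ∀ D ∈ Ds, D.Typed := by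
  induction Ds with
  | nil => simpa [tensorList] using typed_idn _
  | cons D Ds ih => simp [tensorList, typed_tensor, ih]

@[simp] theorem dom_gather (ps : List (ℕ+ × List ℕ+)) :
    (cls (gather ps)).dom = ps.map Prod.fst ++ ps.flatMap Prod.snd := by
  cases ps <;> simp [gather]

@[simp] theorem cod_gather (ps : List (ℕ+ × List ℕ+)) :
    (cls (gather ps)).cod = ps.flatMap fun p => p.1 :: p.2 := by
  induction ps with
  | nil => rfl
  | cons p ps ih => simp [gather, ih]

theorem typed_gather (ps : List (ℕ+ × List ℕ+)) : (gather ps).Typed := by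
  induction ps with
  | nil => exact typed_idn _
  | cons p ps ih =>
    simp only [gather, typed_comp, typed_tensor, typed_idn, typed_braid, ih, true_and]
    simp [← dom_cls, ← cod_cls]

variable {I J : Type} (ℓ : I → J → ℕ+)

@[simp] theorem cod_transpose (is : List I) (js : List J) :
    (cls (transpose ℓ is js)).cod = js.flatMap fun j => is.map fun i => ℓ i j := by
  cases is <;> simp [transpose, List.flatMap_map]

@[simp] theorem dom_transpose (is : List I) (js : List J) :
    (cls (transpose ℓ is js)).dom = is.flatMap fun i => js.map (ℓ i) := by
  induction is with
  | nil => rfl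
  | cons i is ih => simp [transpose, ih]

theorem typed_transpose (is : List I) (js : List J) : (transpose ℓ is js).Typed := by
  induction is with
  | nil => exact typed_idn _
  | cons i is ih =>
    simp only [transpose, typed_comp, typed_tensor, typed_idn, typed_gather, ih, true_and]
    simp [← dom_cls, ← cod_cls, List.flatMap_map, Function.comp_def]

theorem dom_restrict (as : List ℕ+) (b : ℕ+) : (cls (restrict as b)).dom = as := by
  simp [restrict, dom_tensorList, List.flatMap_map, Diagram.dom]

theorem cod_restrict (as : List ℕ+) (b : ℕ+) : (cls (restrict as b)).cod = as := by
  simp [restrict]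

theorem typed_restrict {as : List ℕ+} {b : ℕ+} (h : ∀ a ∈ as, a ≤ b) :
    (restrict as b).Typed := by
  simp only [restrict, typed_comp, typed_tensor, typed_idn, typed_transpose, typed_Z,
    typed_tensorList, typed_coW.2 h, true_and]
  simp [← dom_cls, ← cod_cls, cod_tensorList, typed_Z, List.flatMap_map, Diagram.cod,
    List.replicate_succ]

end DerivedTypes

/-! ### The axioms, as equations between classes -/

theorem Z_fuse (a : ℕ+) (r r' : ℂ) (n m n' m' : ℕ) :
    (cls (Z a r n (m + 1)) ⊗ᶜ one (List.replicate n' a)) ⟫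
        (one (List.replicate m a) ⊗ᶜ cls (Z a r' (n' + 1) m')) =
      cls (Z a (r * r') (n + n') (m + m')) := by
  refine cls_eq_of_typed (.inr (.inr (.inl (.s a r r' n m n' m')))) ?_ ?_ ?_
  · simp [Diagram.dom]
  · simp [Diagram.cod]
  · simp [typed_comp, typed_tensor, typed_Z, typed_idn, Diagram.dom, Diagram.cod,
      List.replicate_succ', List.append_assoc]
    rw [← List.replicate_succ', List.replicate_succ]

theorem Z_bend (a : ℕ+) (r : ℂ) (n m : ℕ) :
    cls (Z a r (n + 1) m) =
      (one [a] ⊗ᶜ cls (Z a r n (m + 1))) ⟫ (cls (cup a) ⊗ᶜ one (List.replicate m a)) := by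
  refine cls_eq_of_typed (.inr (.inl (.Z_bend a r n m))) ?_ ?_ ?_
  · simp [Diagram.dom, List.replicate_succ]
  · simp [Diagram.cod]
  · simp [typed_comp, typed_tensor, typed_Z, typed_cup, typed_idn, Diagram.dom, Diagram.cod,
      List.replicate_succ]

theorem Z_swap (a : ℕ+) (r : ℂ) (i j : ℕ) :
    cls (Z a r 0 (i + 2 + j)) ⟫
        (one (List.replicate i a) ⊗ᶜ cls (swap a a) ⊗ᶜ one (List.replicate j a)) =
      cls (Z a r 0 (i + 2 + j)) := by
  rw [← tensor_assoc]
  refine cls_eq_of_typed (.inr (.inl (.Z_swap a r i j))) ?_ ?_ ?_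
  · simp [Diagram.dom]
  · simp only [Diagram.cod, List.replicate_add]; rfl
  · simp only [typed_comp, typed_tensor, typed_Z, typed_swap, typed_idn, Diagram.dom,
      Diagram.cod, List.replicate_add]
    simp [List.replicate_succ]

theorem W_swap (a b c : ℕ+) (l l' : List ℕ+) :
    cls (W a (l ++ b :: c :: l')) ⟫ (one l ⊗ᶜ cls (swap b c) ⊗ᶜ one l') =
      cls (W a (l ++ c :: b :: l')) := by
  rw [← tensor_assoc]
  refine cls_eq_of_typed (.inr (.inl (.W_swap a b c l l'))) ?_ ?_ ?_
  · simp [Diagram.dom]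
  · simp [Diagram.cod]
  · simp [typed_comp, typed_tensor, typed_swap, typed_idn, typed_W, Diagram.dom, Diagram.cod]
    grind

theorem W_id (a : ℕ+) : cls (W a [a]) = one [a] :=
  cls_eq_of_typed (.inr (.inr (.inl (.id a)))) rfl rfl (by simp [typed_W, typed_idn])

theorem Z_W (a : ℕ+) (r : ℂ) (n : ℕ) (bs : List ℕ+) (hn : n ≠ 0) :
    cls (Z a r n 1) ⟫ cls (W a bs) =
      (cls (tensorList (List.replicate n (W a bs))) ⟫
        cls (transpose (fun (_ : Unit) b => b) (List.replicate n ()) bs)) ⟫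
          cls (tensorList (bs.map fun b => Z b r n 1)) := by
  have h₁ : (cls (tensorList (List.replicate n (W a bs)))).cod =
      (List.replicate n ()).flatMap fun _ => bs := by
    rw [cod_tensorList]
    simp [List.flatMap_replicate, Diagram.cod]
  refine cls_eq_of_typed (.inr (.inr (.inl (.b₁ a r n bs hn)))) ?_ ?_ ?_
  · change _ = (cls (tensorList (List.replicate n (W a bs)))).dom
    rw [dom_tensorList]
    simp [List.flatMap_replicate, Diagram.dom]
  · change _ = (cls (tensorList (bs.map fun b => Z b r n 1))).cod
    rw [cod_tensorList]
    simp [List.flatMap_map, Diagram.cod]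
  · simp only [typed_comp, typed_tensorList, typed_transpose, typed_Z, typed_W]
    simp only [← dom_cls, ← cod_cls, h₁]
    simp [dom_tensorList, List.flatMap_map, typed_Z, typed_W, Diagram.dom, hn]

theorem ketOne_Z (a : ℕ+) (r : ℂ) (n : ℕ) :
    cls (ketOne a) ⟫ cls (Z a r 1 n) =
      cls (scalar r) ⊗ᶜ cls (tensorList (List.replicate n (ketOne a))) := by
  refine cls_eq_of_typed (.inr (.inr (.inl (.cp a r n)))) ?_ ?_ ?_
  · change _ = [] ++ (cls (tensorList (List.replicate n (ketOne a)))).dom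
    rw [dom_tensorList]
    simp [Diagram.dom]
  · change _ = [] ++ (cls (tensorList (List.replicate n (ketOne a)))).cod
    rw [cod_tensorList]
    simp [List.flatMap_replicate, Diagram.cod]
  · simp [typed_comp, typed_tensor, typed_Z, typed_scalar, typed_ketOne, typed_tensorList,
      Diagram.dom, Diagram.cod]

/-- The last two hypotheses are the typing conditions of the nested nodes; the merged node could be
well typed without them. -/
theorem W_W {c b : ℕ+} {l as l' : List ℕ+} (h : b = c ∨ total as ≤ b) (hb : b ≤ c)
    (has : ∀ a ∈ as, a ≤ b) :
    cls (W c (l ++ b :: l')) ⟫ (one l ⊗ᶜ cls (W b as) ⊗ᶜ one l') =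
      cls (W c (l ++ as ++ l')) := by
  rw [← tensor_assoc]
  refine cls_eq_of_typed (.inr (.inr (.inr (.a c b l as l' h)))) ?_ ?_ ?_
  · simp [Diagram.dom]
  · simp [Diagram.cod]
  · simp [typed_comp, typed_tensor, typed_idn, typed_W, Diagram.dom, Diagram.cod]
    grind

theorem W_W_restrict {c b : ℕ+} {as : List ℕ+} (hb : b ≤ c) (has : ∀ a ∈ as, a ≤ b) :
    cls (W c [b]) ⟫ cls (W b as) = cls (W c as) ⟫ cls (restrict as b) := by
  refine cls_eq_of_typed (.inr (.inr (.inr (.o c b as)))) ?_ ?_ ?_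
  · simp [Diagram.dom]
  · exact (cod_restrict as b).symm
  · have h := dom_restrict as b
    rw [dom_cls] at h
    simp [typed_comp, typed_restrict has, typed_W, Diagram.dom, Diagram.cod, hb, h]
    grind

theorem coW_W {c : ℕ+} {as bs : List ℕ+} (h : min (total as) (total bs) ≤ c)
    (has : ∀ a ∈ as, a ≤ c) (hbs : ∀ b ∈ bs, b ≤ c) :
    cls (coW as c) ⟫ cls (W c bs) =
      (cls (tensorList (as.map fun a => W a (bs.map fun b => min a b))) ⟫
        cls (transpose (fun a b => min a b) as bs)) ⟫
          cls (tensorList (bs.map fun b => coW (as.map fun a => min a b) b)) := by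
  have h₁ : ∀ b : ℕ+, (coW (as.map fun a => min a b) b).dom = as.map fun a => min a b :=
    fun b => dom_coW _ _
  have h₂ : ∀ b : ℕ+, (coW (as.map fun a => min a b) b).cod = [b] := fun b => cod_coW _ _
  have h₃ : ∀ b : ℕ+, (coW (as.map fun a => min a b) b).Typed := fun b => by
    simp [typed_coW]
  refine cls_eq_of_typed (.inr (.inr (.inr (.b₂ c as bs h)))) ?_ ?_ ?_
  · change (cls _).dom = (cls (tensorList _)).dom
    rw [dom_tensorList]
    simp [List.flatMap_map, Diagram.dom]
  · change _ = (cls (tensorList _)).cod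
    rw [cod_tensorList]
    simp [List.flatMap_map, Diagram.cod, h₂]
  · simp only [typed_comp, typed_tensorList, typed_transpose, typed_W, typed_coW.2 has]
    simp only [← dom_cls, ← cod_cls]
    simp [dom_tensorList, cod_tensorList, List.flatMap_map, typed_W, h₁, h₃,
      Diagram.cod]
    exact hbs

theorem Z_loop (n m : ℕ) :
    cls (Z 1 1 n (m + 2)) ⟫ (one (List.replicate m 1) ⊗ᶜ cls (cup 1)) = cls (Z 1 1 n m) := by
  refine cls_eq_of_typed (.inr (.inr (.inr (.loop n m)))) ?_ ?_ ?_
  · simp [Diagram.dom]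
  · simp [Diagram.cod]
  · simp [typed_comp, typed_tensor, typed_Z, typed_cup, typed_idn, Diagram.dom, Diagram.cod,
      List.replicate_add]

theorem ketOne_coW {a b : ℕ+} (h : b ≤ a) :
    cls (ketOne b) ⟫ cls (coW [b] a) = cls (ketOne a) := by
  refine cls_eq_of_typed (.inr (.inr (.inr (.i a b)))) ?_ ?_ ?_
  · simp [Diagram.dom]
  · exact cod_coW _ _
  · simp only [typed_comp, typed_ketOne, typed_coW]
    simp [← dom_cls, ← cod_cls, h]

theorem typed_ket (a : ℕ+) : ∀ k, (ket a k).dom = [] ∧ (ket a k).cod = [a] ∧ (ket a k).Typed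
  | 0 => ⟨dom_coW _ _, cod_coW _ _, by simp [ket, typed_coW]⟩
  | 1 => ⟨rfl, rfl, typed_ketOne a⟩
  | k + 2 => by
    obtain ⟨h₁, h₂, h₃⟩ := typed_ket a (k + 1)
    refine ⟨by simp [ket, Diagram.dom, h₁], cod_coW _ _, ?_⟩
    simp only [ket, typed_comp, typed_tensor, typed_coW, h₃, typed_ketOne, Diagram.cod, h₂]
    simp [← dom_cls]

@[simp] theorem dom_ket (a : ℕ+) (k : ℕ) : (cls (ket a k)).dom = [] := (typed_ket a k).1

@[simp] theorem cod_ket (a : ℕ+) (k : ℕ) : (cls (ket a k)).cod = [a] := (typed_ket a k).2.1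

theorem Z_decomposition (a : ℕ+) :
    cls (Z a 1 0 1) =
      cls (scalar (1 / ((a : ℕ).factorial : ℂ))) ⊗ᶜ cls (splitAndLoop a a) := by
  refine cls_eq_of_typed (.inr (.inr (.inr (.u a)))) ?_ ?_ ?_
  · simp [splitAndLoop, Diagram.dom, (typed_ket a a).1]
  · simp [splitAndLoop, Diagram.cod]
  · simp [splitAndLoop, typed_comp, typed_tensor, typed_Z, typed_cup, typed_idn, typed_W,
      typed_scalar, typed_ket, Diagram.dom, Diagram.cod]

/-! ### Spiders and cups -/

theorem coW_eq (bs : List ℕ+) (a : ℕ+) :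
    cls (coW bs a) = (one bs ⊗ᶜ cls (cap a)) ⟫ (one bs ⊗ᶜ cls (W a bs.reverse) ⊗ᶜ one [a]) ⟫
      (cls (nestedCup bs) ⊗ᶜ one [a]) := by
  simp [coW, tensor_assoc]

@[simp] theorem nestedCup_singleton (a : ℕ+) : cls (nestedCup [a]) = cls (cup a) := by
  simp [nestedCup, one_tensor_one]

theorem coW_self (a : ℕ+) : cls (coW [a] a) = one [a] := by
  simp [coW_eq, W_id, one_tensor_one, snake_left]

theorem transpose_cons_pair (a : ℕ+) (as : List ℕ+) :
    cls (transpose (fun a (_ : Bool) => a) (a :: as) [false, true]) =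
      (one [a, a] ⊗ᶜ cls (transpose (fun a (_ : Bool) => a) as [false, true])) ⟫
        (one [a] ⊗ᶜ cls (braidOne a as) ⊗ᶜ one as) := by
  simp [transpose, gather, one_tensor_one, tensor_assoc]

theorem transpose_nil_pair :
    cls (transpose (fun (a : ℕ+) (_ : Bool) => a) [] [false, true]) = one [] := rfl

/-- Axiom (o) with all capacities equal to `a` and a single output: the W-nodes are identities, and
the restriction fuses to this spider. -/
theorem Z_one (a : ℕ+) : cls (Z a 1 1 1) = one [a] := by
  have h := W_W_restrict (c := a) (b := a) (as := [a]) le_rfl (by simp)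
  have h' := Z_fuse a 1 1 1 1 0 0
  simp [restrict, W_id, tensorList, transpose_cons_pair, transpose_nil_pair, coW_self,
    one_tensor_one] at h h'
  rw [h, h']

theorem cup_eq_Z (a : ℕ+) : cls (cup a) = cls (Z a 1 2 0) := by
  have h := Z_bend a 1 1 0
  simpa [Z_one, one_tensor_one] using h.symm

/-- A spider with one input and two outputs becomes one with two inputs and one output if its second
output is bent to the right. -/
theorem Z_bend_right (a : ℕ+) :
    (cls (Z a 1 1 2) ⊗ᶜ one [a]) ⟫ (one [a] ⊗ᶜ cls (cup a)) = cls (Z a 1 2 1) := by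
  have h := Z_fuse a 1 1 1 1 1 0
  rw [cup_eq_Z]
  simpa using h

theorem Z_bend_left (a : ℕ+) :
    (one [a] ⊗ᶜ cls (Z a 1 1 2)) ⟫ (cls (cup a) ⊗ᶜ one [a]) = cls (Z a 1 2 1) := by
  simpa using (Z_bend a 1 1 1).symm

theorem Z_merge_cup (a : ℕ+) :
    (cls (Z a 1 2 1) ⊗ᶜ one [a]) ⟫ cls (cup a) = cls (Z a 1 3 0) := by
  have h := Z_fuse a 1 1 2 0 1 0
  rw [cup_eq_Z]
  simpa using h

theorem Z_merge_cup' (a : ℕ+) :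
    (one [a] ⊗ᶜ cls (Z a 1 2 1)) ⟫ cls (cup a) = cls (Z a 1 3 0) := by
  simpa using (Z_bend a 1 2 0).symm

theorem Z_swap_outputs (a : ℕ+) (i j : ℕ) :
    cls (Z a 1 1 (i + 2 + j)) ⟫
        (one (List.replicate i a) ⊗ᶜ cls (swap a a) ⊗ᶜ one (List.replicate j a)) =
      cls (Z a 1 1 (i + 2 + j)) := by
  -- The permutation law concerns spiders without inputs; the bent input is the first leg, hence the
  -- shift to `i + 1`.
  have h := Z_swap a 1 (i + 1) j
  rw [show i + 1 + 2 + j = i + 2 + j + 1 by ring, List.replicate_succ] at h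
  have h' := Z_bend a 1 0 (i + 2 + j)
  have e : List.replicate (i + 2 + j) a = List.replicate i a ++ a :: a :: List.replicate j a := by
    rw [List.replicate_add, List.replicate_add, List.append_assoc]
    rfl
  rw [h']
  conv_rhs => rw [← h]
  rw [e]
  generalize List.replicate i a = u at *
  generalize List.replicate j a = v at *
  refine eq_of_whisk ?_
  simp

theorem Z_copy_swap (a : ℕ+) : cls (Z a 1 1 2) ⟫ cls (swap a a) = cls (Z a 1 1 2) := by
  simpa using Z_swap_outputs a 0 0

/-! ### Scalars -/

/-- Scalars commute with diagrams. -/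
theorem scalar_comm {s : Cls} (hd : s.dom = []) (hc : s.cod = []) (D : Cls) :
    D ⊗ᶜ s = s ⊗ᶜ D := by
  have h := braid_natural D s
  simpa [hd, hc] using h

theorem scalar_comp {s : Cls} (hc : s.cod = []) (D E : Cls) :
    (s ⊗ᶜ D) ⟫ E = s ⊗ᶜ (D ⟫ E) := by
  refine eq_of_whisk ?_
  simp [hc]

theorem comp_scalar {s : Cls} (hd : s.dom = []) {D E : Cls}
    (h : D.cod = E.dom) : D ⟫ (s ⊗ᶜ E) = s ⊗ᶜ (D ⟫ E) := by
  have h' := interchange (D := one []) (D' := s) (E := D) (E' := E) (by simp [hd]) h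
  rwa [one_nil_tensor, one_comp' hd] at h'

theorem ket_zero (a : ℕ+) : cls (ket a 0) = (cls (cap a)) ⟫ (cls (W a []) ⊗ᶜ one [a]) := by
  simp [ket, coW_eq, nestedCup]

theorem ket_zero_W (a : ℕ+) : cls (ket a 0) ⟫ cls (W a []) = one [] := by
  have h := coW_W (c := a) (as := []) (bs := []) (by simp [total]) (by simp) (by simp)
  simpa [tensorList, transpose, ket] using h

theorem merge_W_nil (a : ℕ+) :
    cls (Z a 1 2 1) ⟫ cls (W a []) = cls (W a []) ⊗ᶜ cls (W a []) := by
  have h := Z_W a 1 2 [] (by simp)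
  simpa [tensorList, transpose, gather, List.replicate] using h

/-- The Z-state is a unit for merging, and `W : [a] → []` turns merging into a parallel product.
Hence this effect absorbs the scalar in question; evaluating it on `|0⟩`, where it is trivial by
(b₂), isolates the scalar. -/
theorem Z_W_nil (a : ℕ+) : cls (Z a 1 0 1) ⟫ cls (W a []) = one [] := by
  have h : cls (W a []) = (cls (Z a 1 0 1) ⟫ cls (W a [])) ⊗ᶜ cls (W a []) := by
    have h₁ := Z_fuse a 1 1 0 0 1 1
    simp [Z_one] at h₁
    have h₂ : cls (W a []) =
        ((cls (Z a 1 0 1) ⊗ᶜ one [a]) ⟫ cls (Z a 1 2 1)) ⟫ cls (W a []) := by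
      simp [h₁]
    rw [comp_assoc, merge_W_nil] at h₂
    rwa [interchange (by simp) (by simp), one_comp' (by simp)] at h₂
  have h₃ := comp_scalar (s := cls (Z a 1 0 1) ⟫ cls (W a [])) (D := cls (ket a 0))
    (E := cls (W a [])) (by simp) (by simp)
  rw [← h, ket_zero_W, tensor_one_nil] at h₃
  exact h₃.symm

theorem cap_erase (a : ℕ+) : cls (cap a) ⟫ (one [a] ⊗ᶜ cls (Z a 1 1 0)) = cls (Z a 1 0 1) := by
  have h := Z_bend a 1 0 0
  simp only [zero_add, List.replicate_zero, tensor_one_nil] at h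
  have h' : cls (Z a 1 0 1) ⟫ ((cls (cap a) ⊗ᶜ one [a]) ⟫ (one [a] ⊗ᶜ cls (cup a))) =
      cls (Z a 1 0 1) := by
    rw [snake_right, comp_one' (by simp)]
  rw [h]
  refine Eq.trans (eq_of_whisk ?_) h'
  simp

theorem ket_zero_erase (a : ℕ+) : cls (ket a 0) ⟫ cls (Z a 1 1 0) = one [] := by
  rw [← Z_W_nil a, ← cap_erase, ket_zero]
  refine eq_of_whisk ?_
  simp

/-- No axiom evaluates scalars directly. By (cp), `|1⟩` absorbs the scalar 1. At capacity 1 the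
state in (u) is `|1⟩` itself, so the Z-state absorbs it as well, and `Z_W_nil` removes the Z-state.
-/
theorem scalar_one : cls (scalar 1) = one [] := by
  have h₁ : cls (ketOne 1) = cls (scalar 1) ⊗ᶜ cls (ketOne 1) := by
    have h := ketOne_Z 1 1 1
    rwa [Z_one, comp_one' (by simp), show cls (tensorList (List.replicate 1 (ketOne 1))) =
      cls (ketOne 1) by simp [tensorList]] at h
  have h₂ := Z_decomposition 1
  have h₃ : cls (splitAndLoop (1 : ℕ+) 1) = cls (scalar 1) ⊗ᶜ cls (splitAndLoop 1 1) := by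
    rw [splitAndLoop, cls_comp, cls_comp]
    conv_lhs => rw [show cls (ket 1 1) = cls (ketOne 1) from rfl, h₁, scalar_comp (by simp),
      scalar_comp (by simp)]
    rfl
  have h₄ : cls (Z 1 1 0 1) = cls (scalar 1) ⊗ᶜ cls (Z 1 1 0 1) := by
    simp only [PNat.one_coe, Nat.factorial_one, Nat.cast_one, div_one] at h₂
    rw [← h₃] at h₂
    rw [h₂, ← h₃]
  have h₅ := Z_W_nil 1
  rw [h₄, scalar_comp (by simp), Z_W_nil, tensor_one_nil] at h₅
  exact h₅

/-! ### Mates -/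

@[simp] theorem nestedCup_nil : cls (nestedCup []) = one [] := rfl

theorem nestedCup_cons (a : ℕ+) (l : List ℕ+) :
    cls (nestedCup (a :: l)) =
      (one [a] ⊗ᶜ cls (nestedCup l) ⊗ᶜ one [a]) ⟫ cls (cup a) := by
  simp [nestedCup, tensor_assoc]

theorem nestedCup_append (l k : List ℕ+) :
    cls (nestedCup (l ++ k)) =
      (one l ⊗ᶜ cls (nestedCup k) ⊗ᶜ one l.reverse) ⟫ cls (nestedCup l) := by
  induction l with
  | nil => simp
  | cons a l ih =>
    rw [List.cons_append, nestedCup_cons, nestedCup_cons, ih]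
    refine eq_of_whisk ?_
    simp

/-- `D'` is the diagram `D` turned by half a turn in the plane. -/
def IsMate (D D' : Cls) : Prop :=
  D'.dom = D.cod.reverse ∧ D'.cod = D.dom.reverse ∧
    (D ⊗ᶜ one D.cod.reverse) ⟫ cls (nestedCup D.cod) =
      (one D.dom ⊗ᶜ D') ⟫ cls (nestedCup D.dom)

theorem IsMate.one (l : List ℕ+) : IsMate (one l) (one l.reverse) := ⟨by simp, by simp, by simp⟩

/-- The factor next to the nested cups slides around them first, so the order of composition is
reversed. -/
theorem IsMate.comp {D D' E E' : Cls} (h : IsMate D D') (k : IsMate E E') (e : D.cod = E.dom) :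
    IsMate (D ⟫ E) (E' ⟫ D') := by
  obtain ⟨h₁, h₂, h₃⟩ := h
  obtain ⟨k₁, k₂, k₃⟩ := k
  refine ⟨by simp [k₁], by simp [h₂], ?_⟩
  simp only [dom_comp, cod_comp]
  calc ((D ⟫ E) ⊗ᶜ Cls.one E.cod.reverse) ⟫ cls (nestedCup E.cod)
      = (D ⊗ᶜ Cls.one E.cod.reverse) ⟫ (E ⊗ᶜ Cls.one E.cod.reverse) ⟫ cls (nestedCup E.cod) :=
        eq_of_whisk (by simp)
    _ = (Cls.one D.dom ⊗ᶜ E') ⟫ (D ⊗ᶜ Cls.one D.cod.reverse) ⟫ cls (nestedCup D.cod) := by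
        rw [k₃]
        refine eq_of_whisk ?_
        simp only [whisk_comp, whisk_tensor, whisk_one, comp_assoc, cod_one, dom_one]
        rw [exchange_left_assoc (D := D) (E := E') [] _ (by simp) (by simp [e, k₂])]
        simp [e, k₁]
    _ = _ := by
        rw [h₃]
        exact eq_of_whisk (by simp)

/-- The nested cups of the right factor lie inside those of the left one, so left and right are
exchanged. -/
theorem IsMate.tensor {D D' E E' : Cls} (h : IsMate D D') (k : IsMate E E') :
    IsMate (D ⊗ᶜ E) (E' ⊗ᶜ D') := by
  obtain ⟨h₁, h₂, h₃⟩ := h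
  obtain ⟨k₁, k₂, k₃⟩ := k
  refine ⟨by simp [h₁, k₁], by simp [h₂, k₂], ?_⟩
  simp only [dom_tensor, cod_tensor, nestedCup_append]
  calc _ = (D ⊗ᶜ ((E ⊗ᶜ Cls.one E.cod.reverse) ⟫ cls (nestedCup E.cod)) ⊗ᶜ
            Cls.one D.cod.reverse) ⟫ cls (nestedCup D.cod) :=
        eq_of_whisk (by simp)
    _ = (Cls.one D.dom ⊗ᶜ ((Cls.one E.dom ⊗ᶜ E') ⟫ cls (nestedCup E.dom)) ⊗ᶜ
          Cls.one D.cod.reverse) ⟫ (D ⊗ᶜ Cls.one D.cod.reverse) ⟫ cls (nestedCup D.cod) := by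
        rw [k₃]
        refine eq_of_whisk ?_
        simp [k₁]
        rw [exchange_left_assoc (D := D) (E := cls (nestedCup E.dom)) [] _ (by simp) (by simp)]
        rw [exchange_left_assoc (D := D) (E := E') E.dom _ (by simp) (by simp [k₂])]
        simp [k₁]
    _ = _ := by
        rw [h₃]
        refine eq_of_whisk ?_
        simp [h₁, h₂, k₁, k₂]
        rw [exchange_left_assoc (D := cls (nestedCup E.dom)) (E := D') [] _ (by simp)
          (by simp [h₂])]
        simp [h₁]

/-- A diagram with one output is determined by its mate. -/
theorem IsMate.unique_one {D E D' : Cls} {a : ℕ+} (hD : D.cod = [a]) (hE : E.cod = [a])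
    (hd : D.dom = E.dom) (h : IsMate D D') (k : IsMate E D') : D = E := by
  have h' := h.2.2
  have k' := k.2.2
  rw [hD] at h'
  rw [hE, ← hd, ← h'] at k'
  refine bend_injective (u := []) hD hE ?_ hd
  simpa using k'.symm

/-- A diagram with two outputs is determined by its mate. -/
theorem IsMate.unique_two {D E D' : Cls} {a b : ℕ+} (hD : D.cod = [a, b]) (hE : E.cod = [a, b])
    (hd : D.dom = E.dom) (h : IsMate D D') (k : IsMate E D') : D = E := by
  have h' := h.2.2
  have k' := k.2.2
  rw [hD] at h'
  rw [hE, ← hd, ← h'] at k'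
  have key : ∀ F : Cls, F.cod = [a, b] →
      (F ⊗ᶜ Cls.one [a, b].reverse) ⟫ cls (nestedCup [a, b]) =
        (((F ⊗ᶜ Cls.one [b]) ⟫ (Cls.one [a] ⊗ᶜ cls (cup b))) ⊗ᶜ Cls.one [a]) ⟫ cls (cup a) := by
    intro F hF
    rw [nestedCup_cons]
    exact eq_of_whisk (by simp [hF])
  rw [key D hD, key E hE] at k'
  refine bend_injective (u := [a]) hD hE ?_ hd
  refine bend_injective (u := []) (a := a) (by simp) (by simp) ?_ (by simp [hd])
  simpa using k'.symm

/-- Naturality moves the wire `x` across the cup; one of the two crossings is then undone by its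
inverse. -/
theorem swap_cup (x y : ℕ+) :
    (cls (swap y x) ⊗ᶜ one [y]) ⟫ (one [x] ⊗ᶜ cls (cup y)) =
      (one [y] ⊗ᶜ cls (swap x y)) ⟫ (cls (cup y) ⊗ᶜ one [x]) := by
  have h := braid_natural (one [x]) (cls (cup y))
  simp [braidOne_cons, one_tensor_one] at h
  rw [h]
  calc _ = ((cls (swap y x) ⟫ cls (swap x y)) ⊗ᶜ one [y]) ⟫
        (one [y] ⊗ᶜ cls (swap x y)) ⟫ (cls (cup y) ⊗ᶜ one [x]) := eq_of_whisk (by simp)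
    _ = _ := by
      rw [swap_swap]
      exact eq_of_whisk (by simp)

theorem IsMate.swap (x y : ℕ+) : IsMate (cls (swap x y)) (cls (swap x y)) := by
  refine ⟨rfl, rfl, ?_⟩
  simp only [dom_swap, cod_swap, nestedCup_cons]
  calc _ = (((cls (Diagram.swap x y) ⊗ᶜ Cls.one [x]) ⟫ (Cls.one [y] ⊗ᶜ cls (cup x))) ⊗ᶜ
          Cls.one [y]) ⟫ cls (cup y) := eq_of_whisk (by simp)
    _ = (Cls.one [x] ⊗ᶜ
          ((cls (Diagram.swap y x) ⊗ᶜ Cls.one [y]) ⟫ (Cls.one [x] ⊗ᶜ cls (cup y)))) ⟫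
            cls (cup x) := by
        rw [swap_cup]
        exact eq_of_whisk (by simp)
    _ = _ := by
        rw [swap_cup]
        exact eq_of_whisk (by simp)

/-- With all legs bent to the inputs, both sides are the same three-legged spider. -/
theorem IsMate.copy (a : ℕ+) : IsMate (cls (Z a 1 1 2)) (cls (Z a 1 2 1)) := by
  refine ⟨rfl, rfl, ?_⟩
  change (_ ⊗ᶜ Cls.one [a, a]) ⟫ cls (nestedCup [a, a]) =
    (Cls.one [a] ⊗ᶜ _) ⟫ cls (nestedCup [a])
  simp only [nestedCup_cons a [a], nestedCup_singleton]
  rw [Z_merge_cup', ← Z_merge_cup, ← Z_bend_right]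
  exact eq_of_whisk (by simp)

theorem IsMate.coW (as : List ℕ+) (a : ℕ+) :
    IsMate (cls (coW as a)) (cls (W a as.reverse)) := by
  refine ⟨by simp, by simp, ?_⟩
  rw [coW_eq]
  simp only [dom_comp, dom_tensor, dom_one, dom_cap, List.append_nil, cod_comp, cod_tensor,
    cod_one, cod_nestedCup, List.nil_append, List.reverse_singleton, nestedCup_singleton]
  calc _ = (Cls.one as ⊗ᶜ ((cls (cap a) ⊗ᶜ Cls.one [a]) ⟫ (Cls.one [a] ⊗ᶜ cls (cup a)))) ⟫
        (Cls.one as ⊗ᶜ cls (W a as.reverse)) ⟫ cls (nestedCup as) := eq_of_whisk (by simp [List.drop_eq_nil_of_le])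
    _ = _ := by
        rw [snake_right]
        exact eq_of_whisk (by simp)

/-! ### Copying through W-nodes -/

theorem merge_W (a x y : ℕ+) :
    cls (Z a 1 2 1) ⟫ cls (W a [x, y]) =
      (cls (W a [x, y]) ⊗ᶜ cls (W a [x, y])) ⟫ (one [x] ⊗ᶜ cls (swap y x) ⊗ᶜ one [y]) ⟫
        (cls (Z x 1 2 1) ⊗ᶜ cls (Z y 1 2 1)) := by
  have h := Z_W a 1 2 [x, y] (by simp)
  simp [tensorList, transpose, gather, List.replicate, one_tensor_one, tensor_assoc] at h
  exact h

/-- This is `merge_W` turned by half a turn. -/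
theorem coW_copy_two (a x y : ℕ+) :
    cls (coW [x, y] a) ⟫ cls (Z a 1 1 2) =
      (cls (Z x 1 1 2) ⊗ᶜ cls (Z y 1 1 2)) ⟫ (one [x] ⊗ᶜ cls (swap x y) ⊗ᶜ one [y]) ⟫
        (cls (coW [x, y] a) ⊗ᶜ cls (coW [x, y] a)) := by
  have hW := IsMate.coW [x, y] a
  have h₁ := hW.comp (IsMate.copy a) (by simp)
  have h₂ := ((IsMate.copy x).tensor (IsMate.copy y)).comp
    ((((IsMate.one [x]).tensor ((IsMate.swap x y).tensor (IsMate.one [y])))).comp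
      (hW.tensor hW) (by simp)) (by simp)
  refine IsMate.unique_two (a := a) (b := a) (by simp) (by simp) (by simp) h₁ ?_
  convert h₂ using 1
  simp only [List.reverse_cons, List.reverse_nil, List.nil_append, List.singleton_append]
  rw [merge_W]
  exact eq_of_whisk (by simp)

/-- Bending the second copies of two wires. -/
theorem copy_two_bend (x y : ℕ+) :
    (((cls (Z x 1 1 2) ⊗ᶜ cls (Z y 1 1 2)) ⟫ (one [x] ⊗ᶜ cls (swap x y) ⊗ᶜ one [y])) ⊗ᶜ
        one [y, x]) ⟫ (one [x, y] ⊗ᶜ cls (nestedCup [x, y])) =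
      (one [x, y] ⊗ᶜ cls (swap y x)) ⟫ (one [x] ⊗ᶜ cls (swap y x) ⊗ᶜ one [y]) ⟫
        (cls (Z x 1 2 1) ⊗ᶜ cls (Z y 1 2 1)) := by
  have nat := braid_natural (cls (Z y 1 2 1)) (one [x])
  simp [braid_cons, one_tensor_one] at nat
  rw [nestedCup_cons]
  calc _ = (cls (Z x 1 1 2) ⊗ᶜ
          (((cls (Z y 1 1 2) ⊗ᶜ one [y]) ⟫ (one [y] ⊗ᶜ cls (cup y))) ⊗ᶜ one [x])) ⟫
        (one [x] ⊗ᶜ ((cls (swap x y) ⊗ᶜ one [x]) ⟫ (one [y] ⊗ᶜ cls (cup x)))) :=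
        eq_of_whisk (by simp)
    _ = (cls (Z x 1 1 2) ⊗ᶜ ((cls (Z y 1 2 1) ⊗ᶜ one [x]) ⟫ cls (swap y x))) ⟫
          (one [x] ⊗ᶜ cls (cup x) ⊗ᶜ one [y]) := by
        rw [Z_bend_right, swap_cup]
        exact eq_of_whisk (by simp)
    _ = (one [x] ⊗ᶜ ((one [y] ⊗ᶜ cls (swap y x)) ⟫ (cls (swap y x) ⊗ᶜ one [y]))) ⟫
          (((cls (Z x 1 1 2) ⊗ᶜ one [x]) ⟫ (one [x] ⊗ᶜ cls (cup x))) ⊗ᶜ cls (Z y 1 2 1)) := by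
        rw [nat]
        exact eq_of_whisk (by simp)
    _ = _ := by
        rw [Z_bend_right]
        exact eq_of_whisk (by simp)

/-- Bending the last output to the inputs turns the copies into merging spiders and the upside-down
node into a W-node; what remains is `merge_W`. -/
theorem W_copy_two (a x y : ℕ+) :
    cls (W a [x, y]) ⟫ (cls (Z x 1 1 2) ⊗ᶜ cls (Z y 1 1 2)) ⟫
        (one [x] ⊗ᶜ cls (swap x y) ⊗ᶜ one [y]) ⟫ (one [x, y] ⊗ᶜ cls (coW [x, y] a)) =
      cls (Z a 1 1 2) ⟫ (cls (W a [x, y]) ⊗ᶜ one [a]) := by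
  refine bend_injective (u := [x, y]) (a := a) (by simp) (by simp) ?_ (by simp)
  have hW := (IsMate.coW [x, y] a).2.2
  simp at hW
  -- The half turn reverses the two legs; the symmetry of the W-node restores their order.
  have hs := W_swap a y x [] []
  simp at hs
  calc _ = (cls (W a [x, y]) ⊗ᶜ one [a]) ⟫
        (((cls (Z x 1 1 2) ⊗ᶜ cls (Z y 1 1 2)) ⟫ (one [x] ⊗ᶜ cls (swap x y) ⊗ᶜ one [y])) ⊗ᶜ
          one [a]) ⟫ (one [x, y] ⊗ᶜ ((cls (coW [x, y] a) ⊗ᶜ one [a]) ⟫ cls (cup a))) :=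
        eq_of_whisk (by simp)
    _ = (cls (W a [x, y]) ⊗ᶜ cls (W a [y, x])) ⟫
        ((((cls (Z x 1 1 2) ⊗ᶜ cls (Z y 1 1 2)) ⟫ (one [x] ⊗ᶜ cls (swap x y) ⊗ᶜ one [y])) ⊗ᶜ
          one [y, x]) ⟫ (one [x, y] ⊗ᶜ cls (nestedCup [x, y]))) := by
        rw [hW]
        exact eq_of_whisk (by simp)
    _ = (cls (W a [x, y]) ⊗ᶜ (cls (W a [y, x]) ⟫ cls (swap y x))) ⟫
          (one [x] ⊗ᶜ cls (swap y x) ⊗ᶜ one [y]) ⟫ (cls (Z x 1 2 1) ⊗ᶜ cls (Z y 1 2 1)) := by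
        rw [copy_two_bend]
        exact eq_of_whisk (by simp)
    _ = ((cls (Z a 1 1 2) ⊗ᶜ one [a]) ⟫ (one [a] ⊗ᶜ cls (cup a))) ⟫ cls (W a [x, y]) := by
        rw [hs, ← merge_W, Z_bend_right]
    _ = _ := eq_of_whisk (by simp)

/-! ### Copying through W-nodes with any number of legs -/

/-- All wires are copied: `as → as ++ as`. -/
def copyAll (as : List ℕ+) : Cls :=
  cls (tensorList (as.map fun a => Z a 1 1 2)) ⟫
    cls (transpose (fun a (_ : Bool) => a) as [false, true])

theorem restrict_eq (as : List ℕ+) (b : ℕ+) :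
    cls (restrict as b) = copyAll as ⟫ (one as ⊗ᶜ (cls (coW as b) ⟫ cls (Z b 1 1 0))) := by
  simp [restrict, copyAll]

@[simp] theorem dom_copyAll (as : List ℕ+) : (copyAll as).dom = as := by
  simp [copyAll, dom_tensorList, List.flatMap_map, Diagram.dom]

@[simp] theorem cod_copyAll (as : List ℕ+) : (copyAll as).cod = as ++ as := by
  simp [copyAll]

@[simp] theorem copyAll_nil : copyAll [] = one [] := by
  simp [copyAll, tensorList, transpose]

theorem copyAll_cons (a : ℕ+) (as : List ℕ+) :
    copyAll (a :: as) =
      (cls (Z a 1 1 2) ⊗ᶜ copyAll as) ⟫ (one [a] ⊗ᶜ cls (braidOne a as) ⊗ᶜ one as) := by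
  have h : (cls (tensorList (as.map fun a => Z a 1 1 2))).cod =
      (cls (transpose (fun a (_ : Bool) => a) as [false, true])).dom := by
    simp [cod_tensorList, List.flatMap_map, Diagram.cod, List.replicate]
  rw [copyAll, copyAll, List.map_cons, tensorList, cls_tensor, transpose_cons_pair, ← comp_assoc,
    interchange (by simp) h, comp_one' (by simp)]

/-- Axiom (a) with equal inner and outer capacity, turned upside down. -/
theorem coW_cons {a : ℕ+} (x : ℕ+) {as : List ℕ+} (has : ∀ b ∈ as, b ≤ a) :
    cls (coW (x :: as) a) = (one [x] ⊗ᶜ cls (coW as a)) ⟫ cls (coW [x, a] a) := by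
  have h := W_W (c := a) (b := a) (l := []) (as := as.reverse) (l' := [x]) (.inl rfl) le_rfl
    (by simpa using has)
  refine IsMate.unique_one (a := a) (by simp) (by simp) (by simp) (IsMate.coW _ _) ?_
  have h' := ((IsMate.one [x]).tensor (IsMate.coW as a)).comp (IsMate.coW [x, a] a) (by simp)
  convert h' using 1
  simpa using h.symm

theorem W_cons {a : ℕ+} (x : ℕ+) {as : List ℕ+} (has : ∀ b ∈ as, b ≤ a) :
    cls (W a (x :: as)) = cls (W a [x, a]) ⟫ (one [x] ⊗ᶜ cls (W a as)) := by
  have h := W_W (c := a) (b := a) (l := [x]) (as := as) (l' := []) (.inl rfl) le_rfl has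
  simpa using h.symm

/-- Upside-down W-nodes are copied by Z-spiders. -/
theorem coW_copy {a : ℕ+} : ∀ {as : List ℕ+}, (∀ b ∈ as, b ≤ a) →
    cls (coW as a) ⟫ cls (Z a 1 1 2) = copyAll as ⟫ (cls (coW as a) ⊗ᶜ cls (coW as a))
  | [], _ => by
    have hW := IsMate.coW [] a
    refine IsMate.unique_two (a := a) (b := a) (by simp) (by simp) (by simp)
      (hW.comp (IsMate.copy a) (by simp)) ?_
    simp only [List.reverse_nil, merge_W_nil, copyAll_nil]
    rw [one_comp' (by simp)]
    exact hW.tensor hW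
  | x :: as, h => by
    have has : ∀ b ∈ as, b ≤ a := fun b hb => h b (by simp [hb])
    have nat := braid_natural (one [x]) (cls (coW as a))
    simp [-whisk_tensor] at nat
    rw [coW_cons x has]
    calc _ = (one [x] ⊗ᶜ cls (coW as a)) ⟫ cls (coW [x, a] a) ⟫ cls (Z a 1 1 2) :=
          eq_of_whisk (by simp)
      _ = (cls (Z x 1 1 2) ⊗ᶜ (cls (coW as a) ⟫ cls (Z a 1 1 2))) ⟫
          (one [x] ⊗ᶜ cls (swap x a) ⊗ᶜ one [a]) ⟫
            (cls (coW [x, a] a) ⊗ᶜ cls (coW [x, a] a)) := by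
          rw [coW_copy_two]
          exact eq_of_whisk (by simp)
      _ = (cls (Z x 1 1 2) ⊗ᶜ copyAll as) ⟫
          (one [x] ⊗ᶜ ((one [x] ⊗ᶜ cls (coW as a)) ⟫ cls (swap x a)) ⊗ᶜ cls (coW as a)) ⟫
            (cls (coW [x, a] a) ⊗ᶜ cls (coW [x, a] a)) := by
          rw [coW_copy has]
          exact eq_of_whisk (by simp)
      _ = _ := by
          rw [nat, copyAll_cons]
          exact eq_of_whisk (by simp)

/-- The form of (b₁) that moves a restriction from the outputs of a W-node to its input. The
induction splits off one leg by (a) and uses `W_copy_two` for it. -/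
theorem W_copy {a : ℕ+} : ∀ {as : List ℕ+}, (∀ b ∈ as, b ≤ a) →
    cls (W a as) ⟫ copyAll as ⟫ (one as ⊗ᶜ cls (coW as a)) =
      cls (Z a 1 1 2) ⟫ (cls (W a as) ⊗ᶜ one [a])
  | [], _ => by
    refine bend_injective (u := []) (a := a) (by simp) (by simp) ?_ (by simp)
    have hW := (IsMate.coW [] a).2.2
    simp at hW
    calc _ = cls (W a []) ⊗ᶜ ((cls (coW [] a) ⊗ᶜ one [a]) ⟫ cls (cup a)) :=
          eq_of_whisk (by simp)
      _ = ((cls (Z a 1 1 2) ⊗ᶜ one [a]) ⟫ (one [a] ⊗ᶜ cls (cup a))) ⟫ cls (W a []) := by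
          rw [hW, Z_bend_right, merge_W_nil]
      _ = _ := eq_of_whisk (by simp)
  | x :: as, h => by
    have has : ∀ b ∈ as, b ≤ a := fun b hb => h b (by simp [hb])
    have nat := braid_natural (one [x]) (cls (coW as a))
    have nat' := braid_natural (one [x]) (cls (W a as))
    simp [-whisk_tensor] at nat nat'
    rw [coW_cons x has, W_cons x has, copyAll_cons]
    calc _ = cls (W a [x, a]) ⟫ (cls (Z x 1 1 2) ⊗ᶜ (cls (W a as) ⟫ copyAll as)) ⟫
          (one [x] ⊗ᶜ cls (braidOne x as) ⊗ᶜ cls (coW as a)) ⟫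
            (one (x :: as) ⊗ᶜ cls (coW [x, a] a)) :=
          eq_of_whisk (by simp)
      _ = cls (W a [x, a]) ⟫
          (cls (Z x 1 1 2) ⊗ᶜ (cls (W a as) ⟫ copyAll as ⟫ (one as ⊗ᶜ cls (coW as a)))) ⟫
          (one [x] ⊗ᶜ cls (braidOne x as) ⊗ᶜ one [a]) ⟫
            (one (x :: as) ⊗ᶜ cls (coW [x, a] a)) := by
          exact eq_of_whisk (by simp [show 1 + (as.length + 1) = as.length + 1 + 1 by omega])
      _ = cls (W a [x, a]) ⟫ (cls (Z x 1 1 2) ⊗ᶜ cls (Z a 1 1 2)) ⟫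
          (one [x] ⊗ᶜ ((one [x] ⊗ᶜ cls (W a as)) ⟫ cls (braidOne x as)) ⊗ᶜ one [a]) ⟫
            (one (x :: as) ⊗ᶜ cls (coW [x, a] a)) := by
          rw [W_copy has]
          exact eq_of_whisk (by simp)
      _ = (cls (W a [x, a]) ⟫ (cls (Z x 1 1 2) ⊗ᶜ cls (Z a 1 1 2)) ⟫
          (one [x] ⊗ᶜ cls (swap x a) ⊗ᶜ one [a]) ⟫ (one [x, a] ⊗ᶜ cls (coW [x, a] a))) ⟫
            (one [x] ⊗ᶜ cls (W a as) ⊗ᶜ one [a]) := by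
          rw [nat']
          exact eq_of_whisk (by simp)
      _ = _ := by
          rw [W_copy_two]
          exact eq_of_whisk (by simp)

/-! ### The states `|k⟩` -/

theorem ketOne_copy (a : ℕ+) :
    cls (ketOne a) ⟫ cls (Z a 1 1 2) = cls (ketOne a) ⊗ᶜ cls (ketOne a) := by
  rw [ketOne_Z, scalar_one]
  simp [tensorList, List.replicate]

/-- Induction on the construction of the state: `|1⟩` is copied by (cp), and the merging node
commutes with copying. -/
theorem ket_copy (a : ℕ+) : ∀ k : ℕ, cls (ket a (k + 1)) ⟫ cls (Z a 1 1 2) =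
    cls (ket a (k + 1)) ⊗ᶜ cls (ket a (k + 1))
  | 0 => ketOne_copy a
  | k + 1 => by
    have nat := braid_natural (cls (ket a (k + 1))) (cls (ketOne a))
    simp [-whisk_tensor] at nat
    simp only [ket, cls_comp, cls_tensor]
    calc _ = (cls (ket a (k + 1)) ⊗ᶜ cls (ketOne a)) ⟫
          (cls (coW [a, a] a) ⟫ cls (Z a 1 1 2)) := eq_of_whisk (by simp)
      _ = ((cls (ket a (k + 1)) ⟫ cls (Z a 1 1 2)) ⊗ᶜ (cls (ketOne a) ⟫ cls (Z a 1 1 2))) ⟫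
          (one [a] ⊗ᶜ cls (swap a a) ⊗ᶜ one [a]) ⟫
            (cls (coW [a, a] a) ⊗ᶜ cls (coW [a, a] a)) := by
          rw [coW_copy_two]
          exact eq_of_whisk (by simp)
      _ = (cls (ket a (k + 1)) ⊗ᶜ
            ((cls (ket a (k + 1)) ⊗ᶜ cls (ketOne a)) ⟫ cls (swap a a)) ⊗ᶜ cls (ketOne a)) ⟫
            (cls (coW [a, a] a) ⊗ᶜ cls (coW [a, a] a)) := by
          rw [ket_copy a k, ketOne_copy]
          exact eq_of_whisk (by simp)
      _ = _ := by
          rw [nat]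
          exact eq_of_whisk (by simp)

/-! ### Erasing the states `|k⟩` -/

theorem copy_erase (a : ℕ+) :
    cls (Z a 1 1 2) ⟫ (one [a] ⊗ᶜ cls (Z a 1 1 0)) = one [a] := by
  have h := Z_fuse a 1 1 1 1 0 0
  simpa [Z_one] using h

/-- A state that is copied by the Z-spider absorbs the scalar obtained by erasing it. -/
theorem ket_absorb (a : ℕ+) (k : ℕ) :
    (cls (ket a (k + 1)) ⟫ cls (Z a 1 1 0)) ⊗ᶜ cls (ket a (k + 1)) = cls (ket a (k + 1)) := by
  have h : cls (ket a (k + 1)) ⟫ cls (Z a 1 1 2) ⟫ (one [a] ⊗ᶜ cls (Z a 1 1 0)) =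
      cls (ket a (k + 1)) := by
    rw [copy_erase, comp_one' (by simp)]
  rw [← comp_assoc, ket_copy, interchange (by simp) (by simp), comp_one' (by simp),
    scalar_comm (by simp) (by simp)] at h
  exact h

/-- The larger state is obtained from the smaller one by merging copies of `|1⟩`, and a scalar
passes through this construction. -/
theorem ket_absorb_of_le (a : ℕ+) {j k : ℕ} (h : j ≤ k) :
    (cls (ket a (j + 1)) ⟫ cls (Z a 1 1 0)) ⊗ᶜ cls (ket a (k + 1)) = cls (ket a (k + 1)) := by
  induction k, h using Nat.le_induction with
  | base => exact ket_absorb a j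
  | succ k _ ih =>
    simp only [ket, cls_comp, cls_tensor]
    rw [← scalar_comp (by simp), ← tensor_assoc, ih]

/-- Erasing a state `|k⟩` leaves the empty diagram. -/
theorem ket_erase (a : ℕ+) {k : ℕ} (hk : k ≤ a) :
    cls (ket a k) ⟫ cls (Z a 1 1 0) = one [] := by
  obtain _ | j := k
  · exact ket_zero_erase a
  -- Writing `a` as a successor makes the absorption lemma applicable to the state `|a⟩` that occurs
  -- in (u).
  obtain ⟨k, hk'⟩ : ∃ k, (a : ℕ) = k + 1 := ⟨a - 1, (Nat.succ_pred_eq_of_pos a.pos).symm⟩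
  have h₁ := ket_absorb_of_le a (show j ≤ k by omega)
  have h₂ := Z_decomposition a
  rw [← hk'] at h₁
  set s := cls (ket a (j + 1)) ⟫ cls (Z a 1 1 0) with hs
  have hd : s.dom = [] := by simp [hs]
  have hc : s.cod = [] := by simp [hs]
  have h₃ : s ⊗ᶜ cls (splitAndLoop a a) = cls (splitAndLoop a a) := by
    rw [splitAndLoop, cls_comp, cls_comp, ← scalar_comp hc, ← scalar_comp hc, h₁]
  have h₄ : s ⊗ᶜ cls (Z a 1 0 1) = cls (Z a 1 0 1) := by
    rw [h₂, ← tensor_assoc, ← scalar_comm hd hc, tensor_assoc, h₃]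
  have h₅ := Z_W_nil a
  rw [← h₄, scalar_comp hc, Z_W_nil, tensor_one_nil] at h₅
  exact h₅

/-! ### Removing loops -/

theorem total_one_le (a : ℕ+) : total [1] ≤ a :=
  le_trans (by simp [total]) (Nat.succ_le_of_lt a.pos)

/-- Sliding one injection around the cup makes it a projection `[a] → [1]`, and injection followed
by projection is the identity by (b₂). -/
theorem inject_cup (a : ℕ+) :
    (cls (coW [1] a) ⊗ᶜ cls (coW [1] a)) ⟫ cls (cup a) = cls (cup 1) := by
  have h := coW_W (c := a) (as := [1]) (bs := [1]) (min_le_of_left_le (total_one_le a)) (by simp) (by simp)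
  have hW := (IsMate.coW [1] a).2.2
  simp [tensorList, transpose, gather, W_id, coW_self] at h hW
  calc _ = (one [1] ⊗ᶜ cls (coW [1] a)) ⟫ ((cls (coW [1] a) ⊗ᶜ one [a]) ⟫ cls (cup a)) :=
        eq_of_whisk (by simp)
    _ = (one [1] ⊗ᶜ (cls (coW [1] a) ⟫ cls (W a [1]))) ⟫ cls (cup 1) := by
        rw [hW]
        exact eq_of_whisk (by simp)
    _ = _ := by
        rw [h]
        exact eq_of_whisk (by simp)

theorem inject_copy (a : ℕ+) :
    cls (coW [1] a) ⟫ cls (Z a 1 1 2) =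
      cls (Z 1 1 1 2) ⟫ (cls (coW [1] a) ⊗ᶜ cls (coW [1] a)) := by
  rw [coW_copy (by simp)]
  simp [copyAll_cons, one_tensor_one]

/-- Merging is copying with one leg bent by a cup, and the injection is compatible with both. -/
theorem inject_merge (a : ℕ+) :
    (cls (coW [1] a) ⊗ᶜ cls (coW [1] a)) ⟫ cls (Z a 1 2 1) =
      cls (Z 1 1 2 1) ⟫ cls (coW [1] a) := by
  rw [← Z_bend_left, ← Z_bend_left]
  calc _ = (cls (coW [1] a) ⊗ᶜ (cls (coW [1] a) ⟫ cls (Z a 1 1 2))) ⟫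
        (cls (cup a) ⊗ᶜ one [a]) := eq_of_whisk (by simp)
    _ = (one [1] ⊗ᶜ cls (Z 1 1 1 2)) ⟫
        (((cls (coW [1] a) ⊗ᶜ cls (coW [1] a)) ⟫ cls (cup a)) ⊗ᶜ cls (coW [1] a)) := by
        rw [inject_copy]
        exact eq_of_whisk (by simp)
    _ = _ := by
        rw [inject_cup]
        exact eq_of_whisk (by simp)

/-- The composite is a spider with three outputs, the first two joined by a cup. Permuting its legs
moves this loop to the last two outputs, where (ℓ) applies. -/
theorem copy_merge_one : cls (Z 1 1 1 2) ⟫ cls (Z 1 1 2 1) = one [(1 : ℕ+)] := by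
  have h₁ := Z_loop 1 1
  have h₂ := Z_fuse 1 1 1 1 1 0 2
  have h₃ := Z_swap_outputs 1 0 1
  have h₄ := Z_swap_outputs 1 1 0
  have nat := braid_natural (one [(1 : ℕ+)]) (cls (cup 1))
  simp [braidOne_cons, one_tensor_one, Z_one] at h₁ h₂ h₃ h₄ nat
  rw [← Z_bend_left]
  calc _ = (cls (Z 1 1 1 2) ⟫ (one [1] ⊗ᶜ cls (Z 1 1 1 2))) ⟫ (cls (cup 1) ⊗ᶜ one [1]) :=
        eq_of_whisk (by simp)
    _ = ((cls (Z 1 1 1 3) ⟫ (cls (swap 1 1) ⊗ᶜ one [1])) ⟫ (one [1] ⊗ᶜ cls (swap 1 1))) ⟫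
        (cls (cup 1) ⊗ᶜ one [1]) := by
        rw [h₂, h₃, h₄]
    _ = cls (Z 1 1 1 3) ⟫ (one [1] ⊗ᶜ cls (cup 1)) := by
        rw [nat]
        exact eq_of_whisk (by simp)
    _ = _ := h₁

/-- A loop between Z-spiders is removed behind a W-node applied to `|1⟩`. -/
theorem ketOne_W_loop (a : ℕ+) :
    cls (ketOne a) ⟫ cls (W a [a, a]) ⟫ (one [a] ⊗ᶜ (cls (Z a 1 1 2) ⟫ cls (Z a 1 2 1))) =
      cls (ketOne a) ⟫ cls (W a [a, a]) := by
  have h := coW_W (c := a) (as := [1]) (bs := [a, a]) (min_le_of_left_le (total_one_le a)) (by simp) (by simp)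
  simp [tensorList, transpose, gather, one_tensor_one] at h
  rw [← ketOne_coW (one_le)]
  calc _ = cls (ketOne 1) ⟫ (cls (coW [1] a) ⟫ cls (W a [a, a])) ⟫
        (one [a] ⊗ᶜ (cls (Z a 1 1 2) ⟫ cls (Z a 1 2 1))) := eq_of_whisk (by simp)
    _ = cls (ketOne 1) ⟫ cls (W 1 [1, 1]) ⟫
        (cls (coW [1] a) ⊗ᶜ ((cls (coW [1] a) ⟫ cls (Z a 1 1 2)) ⟫ cls (Z a 1 2 1))) := by
        rw [h]
        exact eq_of_whisk (by simp)
    _ = cls (ketOne 1) ⟫ cls (W 1 [1, 1]) ⟫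
        (cls (coW [1] a) ⊗ᶜ ((cls (Z 1 1 1 2) ⟫ cls (Z 1 1 2 1)) ⟫ cls (coW [1] a))) := by
        rw [inject_copy, comp_assoc, inject_merge, comp_assoc]
    _ = _ := by
        rw [copy_merge_one, comp_assoc, h, one_comp' (by simp)]

/-! ### The bialgebra of W-nodes with a restriction -/

@[simp] theorem transpose_row {I J : Type} (ℓ : I → J → ℕ+) (i : I) (js : List J) :
    cls (transpose ℓ [i] js) = one (js.map (ℓ i)) := by
  have h : ∀ ks : List J, cls (gather (ks.map fun j => (ℓ i j, []))) = one (ks.map (ℓ i)) := by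
    intro ks
    induction ks with
    | nil => rfl
    | cons k ks ih =>
      have e : ks.flatMap (fun _ => ([] : List ℕ+)) = [] := List.flatMap_eq_nil_iff.2 (by simp)
      simp [gather, ih, one_tensor_one, List.flatMap_map, Function.comp_def, e]
  simp [transpose, h]

@[simp] theorem transpose_column {I J : Type} (ℓ : I → J → ℕ+) (is : List I) (j : J) :
    cls (transpose ℓ is [j]) = one (is.map fun i => ℓ i j) := by
  induction is with
  | nil => rfl
  | cons i is ih => simp [transpose, gather, ih, one_tensor_one]

theorem tensorList_one {as : List ℕ+} {D : ℕ+ → Diagram ℕ+}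
    (h : ∀ a ∈ as, cls (D a) = one [a]) : cls (tensorList (as.map D)) = one as := by
  induction as with
  | nil => rfl
  | cons a as ih =>
    simp [tensorList, ih fun b hb => h b (by simp [hb]), h a (by simp), one_tensor_one]

/-! ### Passing through a wire of larger capacity -/

theorem map_min_eq {a : ℕ+} {bs : List ℕ+} (h : ∀ b ∈ bs, b ≤ a) :
    (bs.map fun b => min a b) = bs := by
  conv_rhs => rw [← List.map_id bs]
  exact List.map_congr_left fun b hb => min_eq_right (h b hb)

/-- (b₂) with a single input: its side condition is just `a ≤ c`, and the bipartite diagram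
degenerates to one W-node. -/
theorem inject_W {a c : ℕ+} {bs : List ℕ+} (hac : a ≤ c) (hbs : ∀ b ∈ bs, b ≤ a) :
    cls (coW [a] c) ⟫ cls (W c bs) = cls (W a bs) := by
  have h := coW_W (c := c) (as := [a]) (bs := bs) (min_le_of_left_le (by simpa [total] using hac))
    (by simpa using hac) fun b hb => (hbs b hb).trans hac
  have h₁ : cls (tensorList (bs.map fun b => coW [min a b] b)) = one bs :=
    tensorList_one fun b hb => by rw [min_eq_right (hbs b hb), coW_self]
  simpa [map_min_eq hbs, tensorList, h₁] using h

theorem coW_project {a c : ℕ+} {as : List ℕ+} (hac : a ≤ c) (has : ∀ b ∈ as, b ≤ a) :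
    cls (coW as c) ⟫ cls (W c [a]) = cls (coW as a) := by
  have h := coW_W (c := c) (as := as) (bs := [a]) (min_le_of_right_le (by simpa [total] using hac))
    (fun b hb => (has b hb).trans hac) (by simpa using hac)
  have h₁ : cls (tensorList (as.map fun b => W b [min b a])) = one as :=
    tensorList_one fun b hb => by rw [min_eq_left (has b hb), W_id]
  have h₂ : (as.map fun b => min b a) = as := by
    simpa only [min_comm] using map_min_eq has
  simpa [h₂, tensorList, h₁] using h

theorem transpose_congr {I J : Type} {ℓ ℓ' : I → J → ℕ+} {is : List I} {js : List J}
    (h : ∀ i ∈ is, ∀ j ∈ js, ℓ i j = ℓ' i j) : transpose ℓ is js = transpose ℓ' is js := by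
  induction is with
  | nil => rfl
  | cons i is ih =>
    have h₁ : js.map (ℓ i) = js.map (ℓ' i) :=
      List.map_congr_left fun j hj => h i (by simp) j hj
    have h₂ : (js.map fun j => (ℓ i j, is.map fun k => ℓ k j)) =
        js.map fun j => (ℓ' i j, is.map fun k => ℓ' k j) :=
      List.map_congr_left fun j hj => by
        rw [h i (by simp) j hj, List.map_congr_left fun k hk => h k (by simp [hk]) j hj]
    rw [transpose, transpose, h₁, h₂, ih fun k hk j hj => h k (by simp [hk]) j hj]

/-- The wire `c` is copied and the effect `E` is applied to the copy. -/
def control (c : ℕ+) (E : Cls) : Cls := cls (Z c 1 1 2) ⟫ (one [c] ⊗ᶜ E)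

/-- Both bendings give the merging spider followed by `E`, because the two outputs of the copying
spider are interchangeable. -/
theorem IsMate.control {c : ℕ+} {E : Cls} (hd : E.dom = [c]) (hc : E.cod = []) :
    IsMate (control c E) (control c E) := by
  have nat := braid_natural (Cls.one [c]) E
  simp [hd, hc] at nat
  refine ⟨by simp [ZW.control, hc, List.replicate], by simp [ZW.control, hc, List.replicate], ?_⟩
  have h : ((ZW.control c E) ⊗ᶜ Cls.one [c]) ⟫ cls (cup c) = cls (Z c 1 2 1) ⟫ E := by
    rw [ZW.control, nat, ← comp_assoc, Z_copy_swap, ← Z_bend_right]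
    exact eq_of_whisk (by simp [hd, hc])
  have h' : (Cls.one [c] ⊗ᶜ (ZW.control c E)) ⟫ cls (cup c) = cls (Z c 1 2 1) ⟫ E := by
    rw [ZW.control, ← Z_bend_left]
    refine eq_of_whisk ?_
    simp [hd, hc]
  simpa [ZW.control, hc] using h.trans h'.symm

/-- Axiom (o) upside down. Instead of turning the restriction itself, the proof moves it through the
W-node: above and below, it becomes the same `control c E` on the single wire `c`, which is its own
mate. -/
theorem coW_inject {a c : ℕ+} {as : List ℕ+} (hac : a ≤ c) (has : ∀ b ∈ as, b ≤ a)
    (hr : as.reverse = as) :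
    cls (coW as a) ⟫ cls (coW [a] c) = cls (restrict as a) ⟫ cls (coW as c) := by
  have has' : ∀ b ∈ as, b ≤ c := fun b hb => (has b hb).trans hac
  -- The effect "project to capacity `a`, then erase": behind the merge into `c` it has the same
  -- result as merging into `a` and erasing.
  obtain ⟨E, hE⟩ : ∃ E : Cls, E = cls (W c [a]) ⟫ cls (Z a 1 1 0) := ⟨_, rfl⟩
  have hd : E.dom = [c] := by simp [hE]
  have hc : E.cod = [] := by simp [hE]
  have hR : cls (restrict as a) = copyAll as ⟫ (one as ⊗ᶜ (cls (coW as c) ⟫ E)) := by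
    rw [restrict_eq, hE, ← comp_assoc (cls (coW as c)), coW_project hac has]
  have h₁ : cls (restrict as a) ⟫ cls (coW as c) = cls (coW as c) ⟫ control c E := by
    rw [hR, control, ← comp_assoc (cls (coW as c)), coW_copy has']
    exact eq_of_whisk (by simp [hd, hc])
  have h₂ : cls (W c [a]) ⟫ cls (W a as) = control c E ⟫ cls (W c as) := by
    rw [W_W_restrict hac has, hR, control]
    calc _ = (cls (W c as) ⟫ copyAll as ⟫ (one as ⊗ᶜ cls (coW as c))) ⟫ (one as ⊗ᶜ E) :=
          eq_of_whisk (by simp)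
      _ = _ := by
          rw [W_copy has']
          exact eq_of_whisk (by simp [hd, hc])
  rw [h₁]
  refine IsMate.unique_one (a := c) (by simp) (by simp [control, hc]) (by simp)
    ((IsMate.coW as a).comp (IsMate.coW [a] c) (by simp)) ?_
  convert (IsMate.coW as c).comp (IsMate.control hd hc) (by simp [control]) using 1
  rw [hr]
  exact h₂

/-- Inserting an injection into a wire `c` in the middle changes nothing after the outgoing W-node
(`inject_W`), but leaves a restriction before the incoming one (`coW_inject`). In between, (b₂)
applies at capacity `c`. -/
theorem coW_W_restrict {a : ℕ+} {as bs : List ℕ+} (has : ∀ b ∈ as, b = a) (hbs : ∀ b ∈ bs, b = a) :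
    cls (coW as a) ⟫ cls (W a bs) =
      cls (restrict as a) ⟫ (cls (tensorList (as.map fun _ => W a bs)) ⟫
        cls (transpose (fun _ _ => a) as bs)) ⟫ cls (tensorList (bs.map fun _ => coW as a)) := by
  -- The bound `a ≤ c` permits the injection; the bound by the total capacity is the side condition
  -- of (b₂).
  obtain ⟨c, hac, hc⟩ : ∃ c : ℕ+, a ≤ c ∧ total as ≤ c :=
    ⟨Nat.succPNat (a + total as), by rw [← PNat.coe_le_coe, Nat.succPNat_coe]; omega,
      by rw [Nat.succPNat_coe]; omega⟩
  have has' : ∀ b ∈ as, b ≤ a := fun b hb => (has b hb).le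
  have hbs' : ∀ b ∈ bs, b ≤ a := fun b hb => (hbs b hb).le
  -- All labels agree, so the reversal caused by the half turn has no effect.
  have hr : as.reverse = as := by
    rw [List.eq_replicate_of_mem has, List.reverse_replicate]
  have h := coW_W (c := c) (as := as) (bs := bs) (min_le_of_left_le hc)
    (fun b hb => (has' b hb).trans hac) fun b hb => (hbs' b hb).trans hac
  have key : cls (coW as a) ⟫ cls (W a bs) =
      cls (restrict as a) ⟫ (cls (coW as c) ⟫ cls (W c bs)) := by
    rw [← comp_assoc, ← coW_inject hac has' hr, comp_assoc, inject_W hac hbs']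
  rw [key, h]
  -- The bipartite wires have capacity `min a a = a`, independently of the auxiliary `c`.
  have e₁ : (as.map fun x => W x (bs.map fun y => min x y)) = as.map fun _ => W a bs :=
    List.map_congr_left fun x hx => by rw [has x hx, map_min_eq hbs']
  have e₂ : (bs.map fun y => coW (as.map fun x => min x y) y) = bs.map fun _ => coW as a :=
    List.map_congr_left fun y hy => by
      simp only [hbs y hy, min_comm _ a, map_min_eq has']
  rw [e₁, e₂, transpose_congr fun x hx y hy => show min x y = a by
    rw [has x hx, hbs y hy, min_self]]

/-! ### Relabelling -/

section Relabel

variable {C C' : Type} (f : C → C')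

theorem relabel_braidOne (a : C) (k : List C) :
    (braidOne a k).relabel f = braidOne (f a) (k.map f) := by
  induction k with
  | nil => rfl
  | cons b k ih => simp [braidOne, Diagram.relabel, ih]

theorem relabel_braid (l k : List C) : (braid l k).relabel f = braid (l.map f) (k.map f) := by
  induction l with
  | nil => rfl
  | cons a l ih => simp [braid, Diagram.relabel, ih, relabel_braidOne]

theorem relabel_nestedCup (l : List C) : (nestedCup l).relabel f = nestedCup (l.map f) := by
  induction l with
  | nil => rfl
  | cons a l ih => simp [nestedCup, Diagram.relabel, ih]

theorem relabel_coW (bs : List C) (a : C) : (coW bs a).relabel f = coW (bs.map f) (f a) := by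
  simp [coW, Diagram.relabel, relabel_nestedCup]

theorem relabel_ket (a : C) : ∀ k, (ket a k).relabel f = ket (f a) k
  | 0 => relabel_coW f [] a
  | 1 => rfl
  | k + 2 => by simp [ket, Diagram.relabel, relabel_ket a (k + 1), relabel_coW]

theorem relabel_tensorList (Ds : List (Diagram C)) :
    (tensorList Ds).relabel f = tensorList (Ds.map (Diagram.relabel f)) := by
  induction Ds with
  | nil => rfl
  | cons D Ds ih => simp [tensorList, Diagram.relabel, ih]

theorem relabel_gather (ps : List (C × List C)) :
    (gather ps).relabel f = gather (ps.map fun p => (f p.1, p.2.map f)) := by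
  induction ps with
  | nil => rfl
  | cons p ps ih =>
    simp [gather, Diagram.relabel, ih, relabel_braid, List.map_flatMap, List.flatMap_map,
      Function.comp_def]

theorem relabel_transpose {I J : Type} (ℓ : I → J → C) (is : List I) (js : List J) :
    (transpose ℓ is js).relabel f = transpose (fun i j => f (ℓ i j)) is js := by
  induction is with
  | nil => rfl
  | cons i is ih =>
    simp [transpose, Diagram.relabel, ih, relabel_gather, Function.comp_def]

/-- In `restrict` and (b₁) lists of labels serve as the index lists of `transpose`, so a relabelling
also acts on the indices. -/
theorem transpose_map {I I' J J' : Type} (ℓ : I' → J' → C) (g : I → I') (h : J → J')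
    (is : List I) (js : List J) :
    transpose ℓ (is.map g) (js.map h) = transpose (fun i j => ℓ (g i) (h j)) is js := by
  induction is with
  | nil => rfl
  | cons i is ih => simp [transpose, ih, Function.comp_def]

theorem relabel_restrict (as : List C) (b : C) :
    (restrict as b).relabel f = restrict (as.map f) (f b) := by
  have h := transpose_map (fun (a : C') (_ : Bool) => a) f id as [false, true]
  simp only [List.map_id] at h
  simp [restrict, Diagram.relabel, relabel_tensorList, relabel_transpose, relabel_coW, h,
    Function.comp_def]

theorem relabel_splitAndLoop (a : C) (k : ℕ) :
    (splitAndLoop a k).relabel f = splitAndLoop (f a) k := by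
  simp [splitAndLoop, Diagram.relabel, relabel_ket]

theorem HasType.relabel [LE C] [LE C'] {f : C → C'} (hf : ∀ a b, a ≤ b → f a ≤ f b)
    {D : Diagram C} {l l' : List C} (h : HasType D l l') :
    HasType (D.relabel f) (l.map f) (l'.map f) := by
  induction h with
  | idn l => exact HasType.idn _
  | comp _ _ h k => exact HasType.comp h k
  | tensor _ _ h k => simpa [Diagram.relabel] using HasType.tensor h k
  | swap a b => exact HasType.swap _ _
  | cup a => exact HasType.cup _
  | cap a => exact HasType.cap _
  | Z a r n m => simpa [Diagram.relabel] using HasType.Z (f a) r n m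
  | W a bs h =>
    refine HasType.W _ _ fun b hb => ?_
    obtain ⟨b', hb', rfl⟩ := List.mem_map.1 hb
    exact hf _ _ (h b' hb')
  | ketOne a => exact HasType.ketOne _
  | scalar r => exact HasType.scalar r

/-- Monotonicity enters through naturality, the one structural law that carries typing assumptions.
-/
theorem Structural.relabel [LE C] [LE C'] {f : C → C'} (hf : ∀ a b, a ≤ b → f a ≤ f b)
    {D E : Diagram C} (h : Structural D E) : Structural (D.relabel f) (E.relabel f) := by
  cases h with
  | comp_assoc D E F => exact .comp_assoc _ _ _
  | id_comp l D => exact .id_comp _ _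
  | comp_id l D => exact .comp_id _ _
  | tensor_assoc D E F => exact .tensor_assoc _ _ _
  | nil_tensor D => exact .nil_tensor _
  | tensor_nil D => exact .tensor_nil _
  | id_tensor l k => simpa [Diagram.relabel] using Structural.id_tensor (l.map f) (k.map f)
  | interchange D D' E E' => exact .interchange _ _ _ _
  | swap_swap a b => exact .swap_swap _ _
  | naturality h k =>
    simpa [Diagram.relabel, relabel_braid] using Structural.naturality (h.relabel hf) (k.relabel hf)
  | cap_swap a => exact .cap_swap _
  | snake_left a => exact .snake_left _
  | snake_right a => exact .snake_right _

theorem Topological.relabel {D E : Diagram C} (h : Topological D E) :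
    Topological (D.relabel f) (E.relabel f) := by
  cases h with
  | Z_bend a r n m => simpa [Diagram.relabel] using Topological.Z_bend (f a) r n m
  | Z_swap a r i j => simpa [Diagram.relabel] using Topological.Z_swap (f a) r i j
  | W_swap a b c l l' =>
    simpa [Diagram.relabel] using
      Topological.W_swap (f a) (f b) (f c) (l.map f) (l'.map f)

theorem CommonAxiom.relabel {D E : Diagram C} (h : CommonAxiom D E) :
    CommonAxiom (D.relabel f) (E.relabel f) := by
  cases h with
  | s a r r' n m n' m' => simpa [Diagram.relabel] using CommonAxiom.s (f a) r r' n m n' m'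
  | id a => exact .id _
  | b₁ a r n bs hn =>
    have h := transpose_map (fun (_ : Unit) (b : C') => b) _root_.id f (List.replicate n ()) bs
    simp only [List.map_id] at h
    simpa [Diagram.relabel, relabel_tensorList, relabel_transpose, h, Function.comp_def] using
      CommonAxiom.b₁ (f a) r n (bs.map f) hn
  | sum a r r' => simpa [Diagram.relabel, relabel_coW] using CommonAxiom.sum (f a) r r'
  | cp a r n =>
    simpa [Diagram.relabel, relabel_tensorList] using CommonAxiom.cp (f a) r n

end Relabel

/-! ### The embedding of `ZW_d` -/

/-- The axioms of `ZW_d`, on wires of capacity `d - 1`, are equalities in `ZW_f`. -/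
theorem cls_relabel_eq_of_quditAxiom {d : ℕ} {c : ℕ+} (hc : (c : ℕ) + 1 = d) {D E : Diagram Unit}
    (hDE : QuditAxiom d D E) :
    cls (D.relabel fun _ => c) = cls (E.relabel fun _ => c) := by
  obtain rfl : d = c + 1 := hc.symm
  have hle : ∀ l : List Unit, ∀ b ∈ l.map fun _ => c, b ≤ c := by simp
  cases hDE with
  | a l bs l' =>
    have h := W_W (l := l.map fun _ => c) (l' := l'.map fun _ => c) (.inl rfl) le_rfl (hle bs)
    simpa [-List.map_const_fun, -List.map_const', Diagram.relabel, tensor_assoc] using h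
  -- The `d` parallel wires of the qudit rule are the `c + 1` wires of the rule at capacity `c`.
  | h =>
    refine cls_eq_of_typed (.inr (.inr (.inr ?_))) ?_ ?_ ?_
    · simpa [Diagram.relabel, relabel_ket] using QufiniteAxiom.h c c
    · simp [Diagram.relabel, Diagram.dom, relabel_ket, typed_ket]
    · simp [Diagram.relabel, Diagram.cod, relabel_ket, typed_ket]
    · simp [Diagram.relabel, relabel_ket, typed_ket, typed_comp, typed_tensor, typed_W, typed_Z,
        Diagram.cod, Diagram.dom]
  | b₂ as bs =>
    have h := coW_W_restrict (a := c) (as := as.map fun _ => c) (bs := bs.map fun _ => c)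
      (by simp) (by simp)
    have e := transpose_map (fun (_ _ : ℕ+) => c) (fun _ => c) (fun _ => c) as bs
    simp only [Diagram.relabel, relabel_coW, relabel_restrict, relabel_tensorList,
      relabel_transpose, List.map_map, Function.comp_def, cls_comp]
    simpa only [e, List.map_map, Function.comp_def, comp_assoc] using h
  | e k hk =>
    simpa [Diagram.relabel, relabel_ket] using ket_erase c (k := k) (by omega)
  | loop =>
    simpa [Diagram.relabel] using ketOne_W_loop c
  | u =>
    simpa [Diagram.relabel, relabel_splitAndLoop] using Z_decomposition c

/-- Equations of `ZW_d` hold in `ZW_f` on wires of capacity `d - 1`. -/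
theorem Derivable.relabel_const {d : ℕ} {c : ℕ+} (hc : (c : ℕ) + 1 = d) {l l' : List Unit}
    {D E : Diagram Unit} (hDE : Derivable (QuditAxiom d) l l' D E) :
    QufiniteDerives (l.map fun _ => c) (l'.map fun _ => c) (D.relabel fun _ => c)
      (E.relabel fun _ => c) := by
  have hf : ∀ a b : Unit, a ≤ b → c ≤ c := fun _ _ _ => le_rfl
  induction hDE with
  | refl h => exact .refl (h.relabel hf)
  | symm _ ih => exact .symm ih
  | trans _ _ ih₁ ih₂ => exact .trans ih₁ ih₂
  | comp _ _ ih₁ ih₂ => exact .comp ih₁ ih₂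
  | tensor _ _ ih₁ ih₂ =>
    rw [List.map_append, List.map_append]
    exact .tensor ih₁ ih₂
  | ax hDE h₁ h₂ =>
    rcases hDE with hDE | hDE | hDE | hDE
    · exact .ax (.inl (hDE.relabel hf)) (h₁.relabel hf) (h₂.relabel hf)
    · exact .ax (.inr (.inl (hDE.relabel _))) (h₁.relabel hf) (h₂.relabel hf)
    · exact .ax (.inr (.inr (.inl (hDE.relabel _)))) (h₁.relabel hf) (h₂.relabel hf)
    · exact derives_of_cls_eq (h₁.relabel hf) (cls_relabel_eq_of_quditAxiom hc hDE)

end ZW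

theorem mainTheorem8 (d : ℕ) (hd : 2 ≤ d) (n m : ℕ) (D₁ D₂ : ZW.Diagram Unit)
    (h : ZW.QuditDerives d n m D₁ D₂) :
    ZW.QufiniteDerives (List.replicate n (ZW.capacity d hd)) (List.replicate m (ZW.capacity d hd))
      (ZW.embed d hd D₁) (ZW.embed d hd D₂) := by
  have hc : (ZW.capacity d hd : ℕ) + 1 = d := Nat.sub_add_cancel (by omega : 1 ≤ d)
  have h' := ZW.Derivable.relabel_const hc h
  rwa [List.map_replicate, List.map_replicate] at h'
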